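/- **Proposition 2.** Let $m_1,m_2,n$ be positive integers, $\ell\in\mathbb Z$, $\alpha=m_1-m_2$, and let $\hat Q_3(m_1,-m_2,n,\ell)$ be the closure of the 3-braid $\beta=(\sigma_1^{m_1}\sigma_2^{-m_2})^n(\sigma_1\sigma_2)^{3\ell}$. Write $[k]_q=\frac{q^k-q^{-k}}{q-q^{-1}}$ and $[N+k]_q=\frac{Aq^k-A^{-1}q^{-k}}{q-q^{-1}}$ (so $A=q^N$), and $$S^*_{[1]}=[N]_q,\quad S^*_{[3,0,0]}=\tfrac{[N]_q[N+1]_q[N+2]_q}{[2]_q[3]_q},\quad S^*_{[1,1,1]}=\tfrac{[N]_q[N-1]_q[N-2]_q}{[2]_q[3]_q},\quad S^*_{[2,1,0]}=\tfrac{[N]_q[N+1]_q[N-1]_q}{[3]_q}.$$ The normalized HOMFLY-PT polynomial of the closure of a 3-braid is $\mathcal H_{[1]}=\frac1{S^*_{[1]}}\sum_{\Xi}S^*_\Xi\,\mathrm{Tr}_\Xi$, where $\Xi$ runs over $[3,0,0],[1,1,1],[2,1,0]$ and $\mathrm{Tr}_\Xi$ is the trace of the image of the braid under $\sigma_i\mapsto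 \mathfrak R_i^{\Xi}$, with $\mathfrak R_1^{[3,0,0]}=\mathfrak R_2^{[3,0,0]}=\frac qA$, $\mathfrak R_1^{[1,1,1]}=\mathfrak R_2^{[1,1,1]}=-\frac1{qA}$, $\mathfrak R^{[2,1,0]}_1=\frac1A\begin{pmatrix}q&0\\0&-q^{-1}\end{pmatrix}$ and $\mathfrak R^{[2,1,0]}_2=U\mathfrak R^{[2,1,0]}_1U^{-1}$, $U=\frac1{[2]_q}\begin{pmatrix}1&\sqrt{[3]_q}\\-\sqrt{[3]_q}&1\end{pmatrix}$. Then, for all complex $q,A$ with $q,A\neq0$, $q^4\ne1$, $q^6\neq1$, $A^2\neq1$, $$\mathcal H_{[1]}^{\hat Q_3(m_1,-m_2,n,\ell)}=\frac1{S^*_{[1]}}\Big(\big(\tfrac qA\big)^{n\alpha+6\ell}S^*_{[3,0,0]}+(-qA)^{-n\alpha-6\ell}S^*_{[1,1,1]}+\big(\tfrac1A\big)^{n\alpha+6\ell}S^*_{[2,1,0]}\,\Omega\Big),$$ $$\Omega=\sum_{j=0}^{\lfloor n/2\rfloor}\sum_{k=1}^{n-j}(-1)^{-n\alpha/2}\binom{k+j-2}{j-1}\binom{n-(k+j-1)}{j}G_{j,k},$$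 $$G_{j,k}=\sum_{k_1=0}^{n+1-2j-k}\sum_{k_2=0}^{k-1}\sum_{k_3=0}^{2j}\sum_{\ell_1=1}^{2}\binom{n-(k+2j-1)}{k_1}\binom{2j}{k_3}\binom{k-1}{k_2}\frac{[3]_q^{\,j+k_1+k_2}}{[2]_q^{\,2n}}(-1)^{\mu(\ell_1)\left(\alpha(k-1-\frac n2)+m_2(k_2-k_1)\right)+k_3(m_2+1)-m_1j}\,q^{\mu(\ell_1)\left(\alpha(-2+2j+2k-n)+2m_2(k_2-k_1)\right)+2m_2(k_3-j)}.$$ Here $\mu$ is the Möbius function, $(-1)^x=e^{i\pi x}$, a sum whose upper limit is less than its lower limit is $0$, and for $j=0$ the coefficient $\binom{k-2}{-1}$ is $1$ if $k=1$ and $0$ if $k\ge2$. Moreover, if $A=q^N$ for some $N\in\mathbb N$, the same expression is the Reshetikhin–Turaev invariant of the closure of $\beta$ in the vector representation $V=\mathbb C^N$ of $U_q(\mathfrak{sl}_N)$, that is, $\frac1{[N]_q}\mathrm{Tr}_{V^{\otimes 3}}\big(K^{\otimes3}\pi(\beta)\big)$, where $\pi(\sigma_i)$ is $q^{-N}$ times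 the standard braiding (with eigenvalues $q,-q^{-1}$) on the factors $i,i+1$ and $K=\mathrm{diag}(q^{1-N},q^{3-N},\dots,q^{N-1})$. -/

import Mathlib

/-! ### The braid group on three strands -/

/-- The single Artin relator `σ₁σ₂σ₁(σ₂σ₁σ₂)⁻¹`. -/
def artinRels : Set (FreeGroup (Fin 2)) :=
  {FreeGroup.of 0 * FreeGroup.of 1 * FreeGroup.of 0 *
    (FreeGroup.of 1 * FreeGroup.of 0 * FreeGroup.of 1)⁻¹}

/-- The braid group `B₃ = ⟨σ₁, σ₂ ∣ σ₁σ₂σ₁ = σ₂σ₁σ₂⟩`. -/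
abbrev B3 : Type := PresentedGroup artinRels

/-- The generator `σ₁`. -/
def sigma1 : B3 := PresentedGroup.of 0

/-- The generator `σ₂`. -/
def sigma2 : B3 := PresentedGroup.of 1

/-- The representation of `B₃` determined by images of the generators that satisfy the
braid relation. -/
def B3.lift {G : Type*} [Group G] (a b : G) (h : a * b * a = b * a * b) : B3 →* G :=
  PresentedGroup.toGroup (f := ![a, b]) (by
    intro r hr
    obtain rfl : r = _ := hr
    simp [h])

/-- The braid `(σ₁^{m₁} σ₂^{-m₂})^n (σ₁σ₂)^{3ℓ}`, whose closure is the twisted generalized hybrid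
weaving link `Q̂₃(m₁, -m₂, n, ℓ)`. -/
def hybridWeavingBraid (m₁ m₂ n : ℕ) (ℓ : ℤ) : B3 :=
  (sigma1 ^ (m₁ : ℤ) * sigma2 ^ (-(m₂ : ℤ))) ^ n * (sigma1 * sigma2) ^ (3 * ℓ)

/-! ### Quantum numbers and quantum dimensions -/

/-- The quantum number `[k]_q = (q^k - q^{-k}) / (q - q^{-1})`. -/
noncomputable def qnum (q : ℂ) (k : ℤ) : ℂ := (q ^ k - q ^ (-k)) / (q - q⁻¹)

/-- The quantum number `[N + k]_q`, with `q^N` replaced by the variable `A`. -/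
noncomputable def qnumA (A q : ℂ) (k : ℤ) : ℂ := (A * q ^ k - A⁻¹ * q ^ (-k)) / (q - q⁻¹)

/-- `S*_{[1]} = [N]`. -/
noncomputable def S1 (A q : ℂ) : ℂ := qnumA A q 0

/-- `S*_{[3,0,0]} = [N][N+1][N+2] / ([2][3])`. -/
noncomputable def S3 (A q : ℂ) : ℂ :=
  qnumA A q 0 * qnumA A q 1 * qnumA A q 2 / (qnum q 2 * qnum q 3)

/-- `S*_{[1,1,1]} = [N][N-1][N-2] / ([2][3])`. -/
noncomputable def S111 (A q : ℂ) : ℂ :=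
  qnumA A q 0 * qnumA A q (-1) * qnumA A q (-2) / (qnum q 2 * qnum q 3)

/-- `S*_{[2,1,0]} = [N][N+1][N-1] / [3]`. -/
noncomputable def S21 (A q : ℂ) : ℂ :=
  qnumA A q 0 * qnumA A q 1 * qnumA A q (-1) / qnum q 3

/-- The values of the variables at which all denominators `q`, `A`, `q - q⁻¹`, `[2]_q`, `[3]_q` and
`S*_{[1]}` are non-zero. -/
structure Generic (q A : ℂ) : Prop where
  q_ne : q ≠ 0
  q4_ne : q ^ 4 ≠ 1
  q6_ne : q ^ 6 ≠ 1
  A_ne : A ≠ 0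
  A2_ne : A ^ 2 ≠ 1

namespace Generic

variable {q A : ℂ}

theorem sub_inv_ne (h : Generic q A) : q - q⁻¹ ≠ 0 := by
  intro h0
  have h1 : q ^ 2 = 1 := by
    have := h.q_ne
    field_simp at h0
    linear_combination h0
  exact h.q4_ne (by linear_combination (q ^ 2 + 1) * h1)

theorem qnum_two (h : Generic q A) : qnum q 2 = q + q⁻¹ := by
  have h1 := h.sub_inv_ne
  rw [qnum, div_eq_iff h1, zpow_neg, zpow_ofNat, ← inv_pow]
  ring

theorem qnum_two_ne (h : Generic q A) : qnum q 2 ≠ 0 := by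
  rw [h.qnum_two]
  intro h0
  have h1 : q ^ 2 = -1 := by
    have := h.q_ne
    field_simp at h0
    linear_combination h0
  exact h.q4_ne (by linear_combination (q ^ 2 - 1) * h1)

theorem qnum_three (h : Generic q A) : qnum q 3 = qnum q 2 ^ 2 - 1 := by
  have h1 := h.sub_inv_ne
  have h2 := mul_inv_cancel₀ h.q_ne
  rw [h.qnum_two, qnum, div_eq_iff h1, zpow_neg, zpow_ofNat, ← inv_pow]
  linear_combination (q⁻¹ - q) * h2

end Generic

/-! ### The character expansion: blocks of the braiding matrices -/

/-- A square root of `[3]_q`. -/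
noncomputable def sqrtThree (q : ℂ) : ℂ := qnum q 3 ^ (1 / 2 : ℂ)

theorem sqrtThree_sq (q : ℂ) : sqrtThree q ^ 2 = qnum q 3 := by
  rw [sqrtThree, ← Complex.cpow_nat_mul]
  simp

/-- The block `R₁^{[2,1,0]} = A⁻¹ diag(q, -q⁻¹)`. -/
noncomputable def R1block {q A : ℂ} (h : Generic q A) : (Matrix (Fin 2) (Fin 2) ℂ)ˣ where
  val := A⁻¹ • !![q, 0; 0, -q⁻¹]
  inv := A • !![q⁻¹, 0; 0, -q]
  val_inv := by
    have hq := h.q_ne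
    have hA := h.A_ne
    ext i j; fin_cases i <;> fin_cases j <;> simp <;> field_simp
  inv_val := by
    have hq := h.q_ne
    have hA := h.A_ne
    ext i j; fin_cases i <;> fin_cases j <;> simp <;> field_simp

/-- The Racah matrix
`U^{[2,1,0]} = [2]⁻¹ ((1, √[3]), (-√[3], 1))`; its inverse is its transpose, which is the conjugate
transpose when `q` is a positive real number. -/
noncomputable def Ublock {q A : ℂ} (h : Generic q A) : (Matrix (Fin 2) (Fin 2) ℂ)ˣ where
  val := (qnum q 2)⁻¹ • !![1, sqrtThree q; -sqrtThree q, 1]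
  inv := (qnum q 2)⁻¹ • !![1, -sqrtThree q; sqrtThree q, 1]
  val_inv := by
    have h2 := h.qnum_two_ne
    have h3 : sqrtThree q ^ 2 = qnum q 2 ^ 2 - 1 := by rw [sqrtThree_sq, h.qnum_three]
    ext i j; fin_cases i <;> fin_cases j <;> simp <;> field_simp <;>
      first | ring1 | linear_combination h3
  inv_val := by
    have h2 := h.qnum_two_ne
    have h3 : sqrtThree q ^ 2 = qnum q 2 ^ 2 - 1 := by rw [sqrtThree_sq, h.qnum_three]
    ext i j; fin_cases i <;> fin_cases j <;> simp <;> field_simp <;>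
      first | ring1 | linear_combination h3

/-- The block `R₂^{[2,1,0]} = U R₁ U†`. -/
noncomputable def R2block {q A : ℂ} (h : Generic q A) : (Matrix (Fin 2) (Fin 2) ℂ)ˣ :=
  Ublock h * R1block h * (Ublock h)⁻¹

theorem block_braid {q A : ℂ} (h : Generic q A) :
    R1block h * R2block h * R1block h = R2block h * R1block h * R2block h := by
  have hq := h.q_ne
  have hA := h.A_ne
  have h2 := h.qnum_two_ne
  have h3 : sqrtThree q ^ 2 = qnum q 2 ^ 2 - 1 := by rw [sqrtThree_sq, h.qnum_three]
  have ht : q ^ 2 = qnum q 2 * q - 1 := by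
    rw [h.qnum_two, add_mul, inv_mul_cancel₀ hq]; ring
  have hR2 : (R2block h : Matrix (Fin 2) (Fin 2) ℂ) = (A⁻¹ * (qnum q 2)⁻¹) •
      !![-q⁻¹ ^ 2, -sqrtThree q; -sqrtThree q, q ^ 2] := by
    change (qnum q 2)⁻¹ • !![1, sqrtThree q; -sqrtThree q, 1] * (A⁻¹ • !![q, 0; 0, -q⁻¹]) *
      ((qnum q 2)⁻¹ • !![1, -sqrtThree q; sqrtThree q, 1]) = _
    ext i j; fin_cases i <;> fin_cases j <;> simp <;> field_simp
    · linear_combination (q + qnum q 2) * ht - q * h3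
    · linear_combination -sqrtThree q * ht
    · linear_combination -sqrtThree q * ht
    · linear_combination q ^ 2 * h3 - (qnum q 2 * q + 1) * ht
  ext1
  rw [Units.val_mul, Units.val_mul, Units.val_mul, Units.val_mul, hR2]
  change (A⁻¹ • !![q, 0; 0, -q⁻¹]) * _ * (A⁻¹ • !![q, 0; 0, -q⁻¹]) =
    _ * (A⁻¹ • !![q, 0; 0, -q⁻¹]) * _
  ext i j; fin_cases i <;> fin_cases j <;> simp <;> field_simp
  · linear_combination q ^ 2 * h3 - (qnum q 2 * q + 1) * ht
  · linear_combination -sqrtThree q * ht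
  · linear_combination -sqrtThree q * ht
  · linear_combination (q + qnum q 2) * ht - q * h3

/-- The action of `B₃` on the two-dimensional multiplicity space of `[2,1,0]`. -/
noncomputable def rho21 {q A : ℂ} (h : Generic q A) : B3 →* (Matrix (Fin 2) (Fin 2) ℂ)ˣ :=
  B3.lift (R1block h) (R2block h) (block_braid h)

/-- The action of `B₃` on the one-dimensional multiplicity space of `[3,0,0]`:
`R₁ = R₂ = q / A`. -/
noncomputable def rho3 {q A : ℂ} (h : Generic q A) : B3 →* ℂˣ :=
  B3.lift (Units.mk0 (q / A) (div_ne_zero h.q_ne h.A_ne))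
    (Units.mk0 (q / A) (div_ne_zero h.q_ne h.A_ne)) rfl

/-- The action of `B₃` on the one-dimensional multiplicity space of `[1,1,1]`:
`R₁ = R₂ = -1 / (q A)`. -/
noncomputable def rho111 {q A : ℂ} (h : Generic q A) : B3 →* ℂˣ :=
  B3.lift (Units.mk0 (-1 / (q * A)) (div_ne_zero (by simp) (mul_ne_zero h.q_ne h.A_ne)))
    (Units.mk0 (-1 / (q * A)) (div_ne_zero (by simp) (mul_ne_zero h.q_ne h.A_ne))) rfl

/-- The normalized two-variable HOMFLY-PT polynomial of the closure of a 3-braid, as a character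
expansion: `(S*_{[1]})⁻¹ ∑_Ξ S*_Ξ · Tr_Ξ β` over the irreducible constituents `Ξ` of `[1]^{⊗3}`. -/
noncomputable def homflyPT {q A : ℂ} (h : Generic q A) (β : B3) : ℂ :=
  1 / S1 A q * (S3 A q * (rho3 h β : ℂ) + S111 A q * (rho111 h β : ℂ) +
    S21 A q * (rho21 h β : Matrix (Fin 2) (Fin 2) ℂ).trace)

/-! ### The quantum trace on `V ⊗ V ⊗ V`, where `V = ℂ^N` is the vector representation -/

/-- `V ⊗ V ⊗ V` for `V = ℂ^N`, in coordinates with respect to the standard basis. -/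
abbrev V3 (N : ℕ) : Type := Fin N × Fin N × Fin N → ℂ

/-- The standard braiding of `U_q(sl_N)` on the first two factors, with eigenvalues `q`, `-q⁻¹`. -/
noncomputable def Rcheck1 (N : ℕ) (q : ℂ) : Module.End ℂ (V3 N) where
  toFun f := fun (a, b, c) =>
    if a = b then q * f (a, b, c)
    else f (b, a, c) + if a < b then (q - q⁻¹) * f (a, b, c) else 0
  map_add' f g := by
    funext ⟨a, b, c⟩; simp only [Pi.add_apply]; split_ifs <;> ring
  map_smul' r f := by
    funext ⟨a, b, c⟩; simp only [Pi.smul_apply, smul_eq_mul, RingHom.id_apply]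
    split_ifs <;> ring

/-- The standard braiding of `U_q(sl_N)` on the last two factors. -/
noncomputable def Rcheck2 (N : ℕ) (q : ℂ) : Module.End ℂ (V3 N) where
  toFun f := fun (a, b, c) =>
    if b = c then q * f (a, b, c)
    else f (a, c, b) + if b < c then (q - q⁻¹) * f (a, b, c) else 0
  map_add' f g := by
    funext ⟨a, b, c⟩; simp only [Pi.add_apply]; split_ifs <;> ring
  map_smul' r f := by
    funext ⟨a, b, c⟩; simp only [Pi.smul_apply, smul_eq_mul, RingHom.id_apply]
    split_ifs <;> ring

theorem Rcheck1_sq (N : ℕ) {q : ℂ} (hq : q ≠ 0) :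
    Rcheck1 N q * Rcheck1 N q = (q - q⁻¹) • Rcheck1 N q + 1 := by
  refine LinearMap.ext fun f => funext fun ⟨a, b, c⟩ => ?_
  simp only [Rcheck1, Module.End.mul_apply, LinearMap.add_apply, LinearMap.smul_apply,
    LinearMap.coe_mk, AddHom.coe_mk, Pi.add_apply, Pi.smul_apply, smul_eq_mul,
    Module.End.one_apply]
  have hqq := mul_inv_cancel₀ hq
  split_ifs <;> first | (exfalso; omega) | linear_combination f (a, b, c) * hqq | grind

theorem Rcheck2_sq (N : ℕ) {q : ℂ} (hq : q ≠ 0) :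
    Rcheck2 N q * Rcheck2 N q = (q - q⁻¹) • Rcheck2 N q + 1 := by
  refine LinearMap.ext fun f => funext fun ⟨a, b, c⟩ => ?_
  simp only [Rcheck2, Module.End.mul_apply, LinearMap.add_apply, LinearMap.smul_apply,
    LinearMap.coe_mk, AddHom.coe_mk, Pi.add_apply, Pi.smul_apply, smul_eq_mul,
    Module.End.one_apply]
  have hqq := mul_inv_cancel₀ hq
  split_ifs <;> first | (exfalso; omega) | linear_combination f (a, b, c) * hqq | grind

theorem Rcheck_braid (N : ℕ) {q : ℂ} (hq : q ≠ 0) :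
    Rcheck1 N q * Rcheck2 N q * Rcheck1 N q = Rcheck2 N q * Rcheck1 N q * Rcheck2 N q := by
  refine LinearMap.ext fun f => funext fun ⟨a, b, c⟩ => ?_
  simp only [Rcheck1, Rcheck2, Module.End.mul_apply, LinearMap.coe_mk, AddHom.coe_mk]
  rcases lt_trichotomy a b with h1 | h1 | h1 <;> rcases lt_trichotomy b c with h2 | h2 | h2 <;>
    rcases lt_trichotomy a c with h3 | h3 | h3 <;>
    first
    | (exfalso; omega)
    | (subst_vars; simp_all [ne_of_gt, ne_of_lt, not_lt_of_gt]; try field_simp; try ring)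

/-- The invertible operator `A⁻¹ R` with `A = q^N`, for an `R` that satisfies the Hecke relation
`R² = (q - q⁻¹) R + 1`. -/
noncomputable def heckeUnit (N : ℕ) {q : ℂ} (hq : q ≠ 0) (R : Module.End ℂ (V3 N))
    (hR : R * R = (q - q⁻¹) • R + 1) : (Module.End ℂ (V3 N))ˣ where
  val := (q ^ N)⁻¹ • R
  inv := q ^ N • (R - (q - q⁻¹) • 1)
  val_inv := by
    rw [smul_mul_smul_comm, inv_mul_cancel₀ (pow_ne_zero N hq), one_smul, mul_sub, hR]
    simp
  inv_val := by
    rw [smul_mul_smul_comm, mul_inv_cancel₀ (pow_ne_zero N hq), one_smul, sub_mul, hR]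
    simp

/-- The action of `B₃` on `V ⊗ V ⊗ V`; the factor `q^{-N}` removes the dependence on framing. -/
noncomputable def piV (N : ℕ) {q : ℂ} (hq : q ≠ 0) : B3 →* (Module.End ℂ (V3 N))ˣ :=
  B3.lift (heckeUnit N hq (Rcheck1 N q) (Rcheck1_sq N hq))
    (heckeUnit N hq (Rcheck2 N q) (Rcheck2_sq N hq)) (by
      ext1
      simp only [heckeUnit, Units.val_mul, smul_mul_smul_comm, Rcheck_braid N hq])

/-- The operator `K ⊗ K ⊗ K` on `V ⊗ V ⊗ V` with
`K = diag(q^{1-N}, q^{3-N}, …, q^{N-1})`, which defines the quantum trace. -/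
noncomputable def K3 (N : ℕ) (q : ℂ) : Module.End ℂ (V3 N) where
  toFun f := fun (a, b, c) =>
    q ^ (2 * (a : ℤ) + 1 - N) * q ^ (2 * (b : ℤ) + 1 - N) * q ^ (2 * (c : ℤ) + 1 - N) *
      f (a, b, c)
  map_add' f g := by
    funext ⟨a, b, c⟩; simp only [Pi.add_apply]; ring
  map_smul' r f := by
    funext ⟨a, b, c⟩; simp only [Pi.smul_apply, smul_eq_mul, RingHom.id_apply]; ring

/-- The Reshetikhin–Turaev invariant of the closure of a 3-braid, coloured by the vector
representation of `U_q(sl_N)`: the quantum trace of the braid, divided by its value `[N]_q` on the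
unknot. -/
noncomputable def quantumTraceInvariant (N : ℕ) {q : ℂ} (hq : q ≠ 0) (β : B3) : ℂ :=
  LinearMap.trace ℂ (V3 N) (K3 N q * (piV N hq β : Module.End ℂ (V3 N))) / qnum q N

/-! ### The multiple binomial sum -/

/-- The binomial coefficient `binom(k+j-2, j-1)` for `k ≥ 1`, with the convention that
`binom(k-2, -1)` is `1` for `k = 1` and `0` for `k ≥ 2`. -/
def pathBinom (j k : ℕ) : ℕ :=
  if j = 0 then (if k = 1 then 1 else 0) else (k + j - 2).choose (j - 1)

/-- The sum `G_{m₁,-m₂,j,k,n}`, with `α = m₁ - m₂` and `(-1)^x = e^{iπx}` for real `x`. The sum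
over `k₁` runs over `0 ≤ k₁ ≤ n + 1 - 2j - k` and is empty when this bound is negative. -/
noncomputable def Gsum (m₁ m₂ : ℕ) (j k n : ℕ) (q : ℂ) : ℂ :=
  let α : ℤ := m₁ - m₂
  ∑ k₁ ∈ Finset.range (n + 2 - (2 * j + k)), ∑ k₂ ∈ Finset.Icc 0 (k - 1),
    ∑ k₃ ∈ Finset.Icc 0 (2 * j), ∑ l₁ ∈ Finset.Icc 1 2,
      ((n + 1 - (k + 2 * j)).choose k₁ : ℂ) * ((2 * j).choose k₃ : ℂ) * ((k - 1).choose k₂ : ℂ) *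
        (qnum q 3 ^ (j + k₁ + k₂) / qnum q 2 ^ (2 * n)) *
        (-1 : ℂ) ^ ((ArithmeticFunction.moebius l₁ : ℂ) *
            ((α : ℂ) * ((k : ℂ) - 1 - (n : ℂ) / 2) + (m₂ : ℂ) * ((k₂ : ℂ) - (k₁ : ℂ))) +
          (k₃ : ℂ) * ((m₂ : ℂ) + 1) - (m₁ : ℂ) * (j : ℂ)) *
        q ^ (ArithmeticFunction.moebius l₁ *
            (α * (-2 + 2 * (j : ℤ) + 2 * (k : ℤ) - (n : ℤ)) +
              2 * (m₂ : ℤ) * ((k₂ : ℤ) - (k₁ : ℤ))) +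
          2 * (m₂ : ℤ) * ((k₃ : ℤ) - (j : ℤ)))

/-- The sum `Ω(m₁, m₂, n; q)`. -/
noncomputable def Omega (m₁ m₂ n : ℕ) (q : ℂ) : ℂ :=
  ∑ j ∈ Finset.Icc 0 (n / 2), ∑ k ∈ Finset.Icc 1 (n - j),
    (-1 : ℂ) ^ (-((n : ℂ) * ((m₁ : ℂ) - (m₂ : ℂ))) / 2) *
      (pathBinom j k : ℂ) * ((n - (k + j - 1)).choose j : ℂ) * Gsum m₁ m₂ j k n q

/-!
The traces of the representations `[3,0,0]` and `[1,1,1]` are powers of a scalar. In `[2,1,0]` the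
full twist `(σ₁σ₂)³` is a scalar, by Cayley–Hamilton, and what remains is the trace of the `n`-th
power of the `2 × 2` matrix of `σ₁^{m₁} σ₂^{-m₂}`, that is, the weighted count of the closed walks
of length `n` on two vertices. Cut such a walk at its returns to the starting vertex: `j` is the
number of excursions to the other vertex, and `k - 1` the number of loops there, so the geometric
series of the loops produce the two outer binomial coefficients of `Ω`. Each loop weight is a
binomial in powers of the eigenvalues `q` and `-q⁻¹` of `σ₁`, and the product of the two
off-diagonal entries is the square of one; expanding these binomials produces `G_{j,k}`, and its
half-integer powers of `-1` combine with the prefactor `(-1)^{-nα/2}` into integer powers.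

For `A = q ^ N`, both the quantum trace and the character expansion are class functions on `B₃`
satisfying the same skein relation. Such a function is determined by its values at `1`, `σ₁` and
`σ₁σ₂`, and at these three braids the two agree.
-/

section WalkSeries

open PowerSeries
open Finset.HasAntidiagonal (antidiagonal)

variable {R : Type*} [CommRing R]

/-- The geometric series `1 / (1 - a X)`. -/
def geomSeries (a : R) : R⟦X⟧ := mk fun n => a ^ n

theorem geomSeries_mul_one_sub (a : R) : geomSeries a * (1 - C a * X) = 1 := by
  ext n
  rw [mul_sub, mul_one, mul_left_comm, ← mul_assoc, map_sub]
  cases n with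
  | zero => simp [geomSeries]
  | succ n => simp [geomSeries, mul_assoc, coeff_succ_mul_X, coeff_one, pow_succ']

theorem eq_geomSeries_mul_of_eq_add {a : R} {f g : R⟦X⟧} (h : f = g + C a * X * f) :
    f = geomSeries a * g := by
  have hg : g = (1 - C a * X) * f := by linear_combination -h
  rw [hg, ← mul_assoc, geomSeries_mul_one_sub, one_mul]

theorem coeff_geomSeries_pow_succ (a : R) (m n : ℕ) :
    coeff n (geomSeries a ^ (m + 1)) = ((n + m).choose m : R) * a ^ n := by
  have : geomSeries a = rescale a (mk 1) := by ext; simp [geomSeries, coeff_rescale]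
  rw [this, ← map_pow, mk_one_pow_eq_mk_choose_add, coeff_rescale, coeff_mk, mul_comm, add_comm n]

theorem coeff_geomSeries_pow (a : R) (m n : ℕ) :
    coeff n (geomSeries a ^ m) = (pathBinom m (n + 1) : R) * a ^ n := by
  cases m with
  | zero => cases n <;> simp [pathBinom, coeff_one]
  | succ m =>
    rw [coeff_geomSeries_pow_succ, pathBinom, if_neg m.succ_ne_zero]
    congr 3
    omega

/-- The generating series `∑ₙ (Mⁿ)ᵢⱼ Xⁿ` of the weighted walks from `i` to `j`. -/
def walkSeries {ι : Type*} [Fintype ι] [DecidableEq ι] (M : Matrix ι ι R) (i j : ι) : R⟦X⟧ :=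
  mk fun n => (M ^ n) i j

theorem walkSeries_eq_add_sum {ι : Type*} [Fintype ι] [DecidableEq ι] (M : Matrix ι ι R)
    (i j : ι) :
    walkSeries M i j =
      C ((1 : Matrix ι ι R) i j) + X * ∑ k, C (M i k) * walkSeries M k j := by
  ext n
  cases n with
  | zero => simp [walkSeries]
  | succ n => simp [walkSeries, coeff_succ_X_mul, pow_succ', Matrix.mul_apply]

theorem walkSeries_self_eq_first_return (M : Matrix (Fin 2) (Fin 2) R) {i j : Fin 2}
    (hij : i ≠ j) :
    walkSeries M i i = geomSeries (M i i) +
      C (M i j * M j i) * X ^ 2 * geomSeries (M i i) * geomSeries (M j j) *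
        walkSeries M i i := by
  have step (k : Fin 2) : walkSeries M k i = C ((1 : Matrix (Fin 2) (Fin 2) R) k i) +
      X * (C (M k i) * walkSeries M i i + C (M k j) * walkSeries M j i) := by
    rw [walkSeries_eq_add_sum, Fintype.sum_eq_add i j hij fun k hk => by omega]
  have excursion : walkSeries M j i = geomSeries (M j j) * (C (M j i) * X * walkSeries M i i) := by
    refine eq_geomSeries_mul_of_eq_add ((step j).trans ?_)
    rw [Matrix.one_apply_ne hij.symm, map_zero]
    ring
  have return_to : walkSeries M i i =
      geomSeries (M i i) * (1 + C (M i j) * X * walkSeries M j i) := by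
    refine eq_geomSeries_mul_of_eq_add ((step i).trans ?_)
    rw [Matrix.one_apply_eq, map_one]
    ring
  conv_lhs => rw [return_to, excursion]
  rw [map_mul]
  ring

theorem eq_sum_pow_mul_add_of_eq_add_mul {S : Type*} [Semiring S] {f g t : S}
    (h : f = g + t * f) (J : ℕ) :
    f = ∑ m ∈ Finset.range J, t ^ m * g + t ^ J * f := by
  induction J with
  | zero => simp
  | succ J ih =>
    rw [Finset.sum_range_succ, pow_succ, mul_assoc, add_assoc, ← mul_add, ← h]
    exact ih

theorem matrix_pow_apply_self (M : Matrix (Fin 2) (Fin 2) R) {i j : Fin 2} (hij : i ≠ j)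
    (n : ℕ) :
    (M ^ n) i i = ∑ m ∈ Finset.range (n / 2 + 1), (M i j * M j i) ^ m *
      ∑ k ∈ antidiagonal (n - 2 * m),
        (pathBinom m (k.1 + 1) : R) * ((k.2 + m).choose m : R) *
          (M j j ^ k.1 * M i i ^ k.2) := by
  set t : R⟦X⟧ := C (M i j * M j i) * X ^ 2 * geomSeries (M i i) * geomSeries (M j j) with ht
  have t_pow (m : ℕ) (f : R⟦X⟧) : t ^ m * f = X ^ (2 * m) *
      (C ((M i j * M j i) ^ m) * (geomSeries (M j j) ^ m * (geomSeries (M i i) ^ m * f))) := by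
    rw [ht, map_pow]
    ring
  have remainder : coeff n (t ^ (n / 2 + 1) * walkSeries M i i) = 0 := by
    rw [t_pow, coeff_X_pow_mul', if_neg (by omega)]
  have expansion := congrArg (coeff n)
    (eq_sum_pow_mul_add_of_eq_add_mul (walkSeries_self_eq_first_return M hij) (n / 2 + 1))
  rw [← ht, map_add, remainder, add_zero, map_sum, walkSeries, coeff_mk] at expansion
  rw [expansion]
  refine Finset.sum_congr rfl fun m hm => ?_
  have hm : 2 * m ≤ n := by have := Finset.mem_range.mp hm; omega
  rw [t_pow, coeff_X_pow_mul', if_pos hm, coeff_C_mul, ← pow_succ, coeff_mul]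
  congr 1
  refine Finset.sum_congr rfl fun k _ => ?_
  rw [coeff_geomSeries_pow, coeff_geomSeries_pow_succ]
  ring

theorem trace_matrix_pow (M : Matrix (Fin 2) (Fin 2) R) (n : ℕ) :
    (M ^ n).trace = ∑ j ∈ Finset.range (n / 2 + 1), ∑ k ∈ antidiagonal (n - 2 * j),
      (pathBinom j (k.1 + 1) : R) * ((k.2 + j).choose j : R) *
        ((M 0 1 * M 1 0) ^ j *
          (M 1 1 ^ k.1 * M 0 0 ^ k.2 + M 0 0 ^ k.1 * M 1 1 ^ k.2)) := by
  rw [Matrix.trace_fin_two, matrix_pow_apply_self M zero_ne_one,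
    matrix_pow_apply_self M one_ne_zero, ← Finset.sum_add_distrib]
  refine Finset.sum_congr rfl fun j _ => ?_
  rw [Finset.mul_sum, Finset.mul_sum, ← Finset.sum_add_distrib]
  exact Finset.sum_congr rfl fun k _ => by ring

end WalkSeries

section OmegaExpansion

open Finset.HasAntidiagonal (antidiagonal)

theorem sum_pathBinom_mul_choose_eq_sum_antidiagonal {R : Type*} [CommSemiring R] {n j : ℕ}
    (hn : 0 < n) (hj : 2 * j ≤ n) (f : ℕ → R) :
    ∑ k ∈ Finset.Icc 1 (n - j), (pathBinom j k : R) * ((n - (k + j - 1)).choose j : R) * f k =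
      ∑ k ∈ antidiagonal (n - 2 * j),
        (pathBinom j (k.1 + 1) : R) * ((k.2 + j).choose j : R) * f (k.1 + 1) := by
  rw [Finset.Nat.sum_antidiagonal_eq_sum_range_succ_mk, ← Finset.Ico_add_one_right_eq_Icc,
    Finset.sum_Ico_eq_sum_range, Nat.add_sub_cancel]
  rcases j.eq_zero_or_pos with rfl | hj_pos
  · rw [Finset.sum_range_succ]
    simp [pathBinom, hn.ne', add_comm]
  · refine (Finset.sum_subset (Finset.range_mono (by omega)) fun p hp hp' => ?_).symm.trans
      (Finset.sum_congr rfl fun p hp => ?_)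
    · have : n - (1 + p + j - 1) < j := by rw [Finset.mem_range] at hp hp'; omega
      rw [Nat.choose_eq_zero_of_lt this, Nat.cast_zero, mul_zero, zero_mul]
    · have : n - 2 * j - p + j = n - (1 + p + j - 1) := by rw [Finset.mem_range] at hp; omega
      rw [this, add_comm p]

/-- The diagonal entry of `σ₁^{m₁} σ₂^{-m₂}` on the multiplicity space of `[2,1,0]`, up to a power
of `A`, at the eigenvector of `σ₁` with eigenvalue `x`; the other eigenvalue is `y`. -/
noncomputable def loopWeight (m₁ m₂ : ℕ) (q x y : ℂ) : ℂ :=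
  x ^ m₁ * (qnum q 3 * y ^ (-m₂ : ℤ) + x ^ (-m₂ : ℤ)) / qnum q 2 ^ 2

/-- The product of the two off-diagonal entries of the matrix of `loopWeight`. -/
noncomputable def excursionWeight (m₁ m₂ : ℕ) (q : ℂ) : ℂ :=
  (-1) ^ m₁ * qnum q 3 * ((-q⁻¹) ^ (-m₂ : ℤ) - q ^ (-m₂ : ℤ)) ^ 2 / qnum q 2 ^ 4

/-- The monomial indexed by `k₁`, `k₂`, `k₃` in the binomial expansion of `j` excursions, `p` loops
at `y` and `r` loops at `x`. -/
noncomputable def eigenMonomial (m₁ m₂ j p r k₁ k₂ k₃ : ℕ) (q x y : ℂ) : ℂ :=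
  (-1) ^ (m₁ * j) * ((-q⁻¹) ^ (-m₂ : ℤ)) ^ k₃ * (-q ^ (-m₂ : ℤ)) ^ (2 * j - k₃) *
    ((x ^ m₁) ^ p * (y ^ (-m₂ : ℤ)) ^ k₂ * (x ^ (-m₂ : ℤ)) ^ (p - k₂)) *
    ((y ^ m₁) ^ r * (x ^ (-m₂ : ℤ)) ^ k₁ * (y ^ (-m₂ : ℤ)) ^ (r - k₁))

theorem add_pow_mul_add_pow_mul_add_pow {R : Type*} [CommSemiring R] (u v y₁ y₂ z₁ z₂ : R)
    (i p r : ℕ) :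
    (u + v) ^ i * (y₂ + y₁) ^ p * (z₂ + z₁) ^ r =
      ∑ k₁ ∈ Finset.range (r + 1), ∑ k₂ ∈ Finset.range (p + 1), ∑ k₃ ∈ Finset.range (i + 1),
        (r.choose k₁ : R) * (i.choose k₃ : R) * (p.choose k₂ : R) *
          (u ^ k₃ * v ^ (i - k₃) * (y₂ ^ k₂ * y₁ ^ (p - k₂)) * (z₂ ^ k₁ * z₁ ^ (r - k₁))) := by
  rw [mul_comm, add_pow z₂, Finset.sum_mul]
  refine Finset.sum_congr rfl fun k₁ _ => ?_
  rw [mul_comm (_ ^ i), add_pow y₂, Finset.sum_mul, Finset.mul_sum]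
  refine Finset.sum_congr rfl fun k₂ _ => ?_
  rw [add_pow u, Finset.mul_sum, Finset.mul_sum]
  exact Finset.sum_congr rfl fun k₃ _ => by ring

theorem weight_pow_mul_eq_sum_eigenMonomial (m₁ m₂ j p r : ℕ) (q x y : ℂ) :
    excursionWeight m₁ m₂ q ^ j * (loopWeight m₁ m₂ q x y ^ p * loopWeight m₁ m₂ q y x ^ r) =
      ∑ k₁ ∈ Finset.range (r + 1), ∑ k₂ ∈ Finset.range (p + 1),
        ∑ k₃ ∈ Finset.range (2 * j + 1),
          (r.choose k₁ : ℂ) * ((2 * j).choose k₃ : ℂ) * (p.choose k₂ : ℂ) *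
            (qnum q 3 ^ (j + k₁ + k₂) / qnum q 2 ^ (2 * (p + r + 2 * j))) *
              eigenMonomial m₁ m₂ j p r k₁ k₂ k₃ q x y := by
  set c : ℂ := (-1) ^ (m₁ * j) * (x ^ m₁) ^ p * (y ^ m₁) ^ r * qnum q 3 ^ j /
    qnum q 2 ^ (2 * (p + r + 2 * j)) with hc
  have factor : excursionWeight m₁ m₂ q ^ j *
      (loopWeight m₁ m₂ q x y ^ p * loopWeight m₁ m₂ q y x ^ r) =
      c * (((-q⁻¹) ^ (-m₂ : ℤ) + -q ^ (-m₂ : ℤ)) ^ (2 * j) *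
        (qnum q 3 * y ^ (-m₂ : ℤ) + x ^ (-m₂ : ℤ)) ^ p *
        (qnum q 3 * x ^ (-m₂ : ℤ) + y ^ (-m₂ : ℤ)) ^ r) := by
    rw [excursionWeight, loopWeight, loopWeight, hc, ← sub_eq_add_neg]
    simp only [div_pow, mul_pow, ← pow_mul]
    ring
  rw [factor, add_pow_mul_add_pow_mul_add_pow, Finset.mul_sum]
  refine Finset.sum_congr rfl fun k₁ _ => ?_
  rw [Finset.mul_sum]
  refine Finset.sum_congr rfl fun k₂ _ => ?_
  rw [Finset.mul_sum]
  refine Finset.sum_congr rfl fun k₃ _ => ?_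
  rw [hc, eigenMonomial, mul_pow, mul_pow]
  ring

theorem neg_one_zpow_congr {K : Type*} [DivisionRing K] {e e' : ℤ} (h : Even (e - e')) :
    (-1 : K) ^ e = (-1) ^ e' := by
  rw [← sub_add_cancel e e', zpow_add₀ (neg_ne_zero.mpr one_ne_zero), h.neg_one_zpow, one_mul]

theorem neg_inv_zpow {K : Type*} [Field K] (x : K) (e : ℤ) : (-x⁻¹) ^ e = (-1) ^ e * x ^ (-e) := by
  rw [neg_eq_neg_one_mul, mul_zpow, inv_zpow']

theorem excursion_monomial_eq_zpow {m₁ m₂ j k₃ : ℕ} (h₃ : k₃ ≤ 2 * j) {q : ℂ} (hq : q ≠ 0) :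
    (-1) ^ (m₁ * j) * ((-q⁻¹) ^ (-m₂ : ℤ)) ^ k₃ * (-q ^ (-m₂ : ℤ)) ^ (2 * j - k₃) =
      (-1) ^ (m₁ * j + (m₂ + 1) * k₃ : ℤ) * q ^ (2 * m₂ * (k₃ - j) : ℤ) := by
  have h1 : (-1 : ℂ) ≠ 0 := by norm_num
  obtain ⟨i, hi⟩ := Nat.exists_eq_add_of_le h₃
  rw [hi, Nat.add_sub_cancel_left]
  calc
    _ = (-1 : ℂ) ^ ((m₁ * j + i : ℕ) : ℤ) * (-1) ^ (-m₂ * k₃ : ℤ) *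
        (q ^ (-(-m₂ : ℤ) * k₃) * q ^ (-m₂ * i : ℤ)) := by
      rw [neg_inv_zpow, neg_pow, mul_pow]
      simp only [zpow_mul, zpow_natCast]
      ring
    _ = (-1) ^ ((m₁ * j + i : ℕ) + -m₂ * k₃ : ℤ) * q ^ (-(-m₂ : ℤ) * k₃ + -m₂ * i) := by
      rw [zpow_add₀ hq, zpow_add₀ h1]
    _ = _ := by
      have hi : (2 * j : ℤ) = k₃ + i := by exact_mod_cast hi
      congr 1
      · refine neg_one_zpow_congr ⟨j - (m₂ + 1) * k₃, ?_⟩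
        push_cast
        linear_combination -hi
      · congr 1
        linear_combination m₂ * hi

theorem loop_monomial_eq_zpow {m₁ m₂ p r k₁ k₂ : ℕ} (h₁ : k₁ ≤ r) (h₂ : k₂ ≤ p)
    {x y : ℂ} (hxy : x * y = -1) :
    ((x ^ m₁) ^ p * (y ^ (-m₂ : ℤ)) ^ k₂ * (x ^ (-m₂ : ℤ)) ^ (p - k₂)) *
        ((y ^ m₁) ^ r * (x ^ (-m₂ : ℤ)) ^ k₁ * (y ^ (-m₂ : ℤ)) ^ (r - k₁)) =
      (-1) ^ ((m₁ - m₂) * r - m₂ * (k₂ - k₁) : ℤ) *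
        x ^ ((m₁ - m₂) * (p - r) + 2 * m₂ * (k₂ - k₁) : ℤ) := by
  have hx : x ≠ 0 := left_ne_zero_of_mul (hxy.trans_ne (by norm_num))
  have hy : y ≠ 0 := right_ne_zero_of_mul (hxy.trans_ne (by norm_num))
  obtain ⟨r', rfl⟩ := Nat.exists_eq_add_of_le h₁
  obtain ⟨p', rfl⟩ := Nat.exists_eq_add_of_le h₂
  rw [Nat.add_sub_cancel_left, Nat.add_sub_cancel_left]
  calc
    _ = (x ^ (m₁ * (k₂ + p') : ℤ) * x ^ (-m₂ * p' : ℤ) * x ^ (-m₂ * k₁ : ℤ)) *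
        (y ^ (m₁ * (k₁ + r') : ℤ) * y ^ (-m₂ * k₂ : ℤ) * y ^ (-m₂ * r' : ℤ)) := by
      simp only [zpow_mul, zpow_natCast, ← Nat.cast_add]
      ring
    _ = x ^ (m₁ * (k₂ + p') + -m₂ * p' + -m₂ * k₁ : ℤ) *
        y ^ (m₁ * (k₁ + r') + -m₂ * k₂ + -m₂ * r' : ℤ) := by
      simp only [zpow_add₀ hx, zpow_add₀ hy]
    _ = _ := by
      rw [show y = -x⁻¹ by rw [← mul_right_inj' hx, hxy]; simp [hx], neg_inv_zpow,
        mul_left_comm, ← zpow_add₀ hx]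
      push_cast
      congr 1
      · congr 1
        ring
      · congr 1
        ring

theorem eigenMonomial_eq_zpow {m₁ m₂ j p r k₁ k₂ k₃ : ℕ} (h₁ : k₁ ≤ r) (h₂ : k₂ ≤ p)
    (h₃ : k₃ ≤ 2 * j) {q x y : ℂ} (hq : q ≠ 0) (hxy : x * y = -1) :
    eigenMonomial m₁ m₂ j p r k₁ k₂ k₃ q x y =
      (-1) ^ (m₁ * j + (m₂ + 1) * k₃ + ((m₁ - m₂) * r - m₂ * (k₂ - k₁)) : ℤ) *
        (q ^ (2 * m₂ * (k₃ - j) : ℤ) * x ^ ((m₁ - m₂) * (p - r) + 2 * m₂ * (k₂ - k₁) : ℤ)) := by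
  rw [eigenMonomial, mul_assoc, excursion_monomial_eq_zpow h₃ hq, loop_monomial_eq_zpow h₁ h₂ hxy,
    zpow_add₀ (neg_ne_zero.mpr one_ne_zero) (m₁ * j + (m₂ + 1) * k₃ : ℤ)]
  ring

theorem neg_one_cpow_mul_cpow {u v : ℂ} {e : ℤ} (h : u + v = e) :
    (-1 : ℂ) ^ u * (-1 : ℂ) ^ v = (-1) ^ e := by
  rw [← Complex.cpow_add _ _ (by norm_num), h, Complex.cpow_intCast]

/-- The signed monomial of the summand of `Gsum` with index `(k₁, k₂, k₃, l₁)`, where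
`ε = μ(l₁)`. -/
noncomputable def gMonomial (m₁ m₂ j k n k₁ k₂ k₃ : ℕ) (ε : ℤ) (q : ℂ) : ℂ :=
  (-1 : ℂ) ^ ((ε : ℂ) * ((((m₁ - m₂ : ℤ) : ℤ) : ℂ) * ((k : ℂ) - 1 - (n : ℂ) / 2) +
      (m₂ : ℂ) * ((k₂ : ℂ) - (k₁ : ℂ))) + (k₃ : ℂ) * ((m₂ : ℂ) + 1) - (m₁ : ℂ) * (j : ℂ)) *
    q ^ (ε * ((m₁ - m₂ : ℤ) * (-2 + 2 * (j : ℤ) + 2 * (k : ℤ) - (n : ℤ)) +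
      2 * (m₂ : ℤ) * ((k₂ : ℤ) - (k₁ : ℤ))) + 2 * (m₂ : ℤ) * ((k₃ : ℤ) - (j : ℤ)))

theorem Gsum_eq_sum_gMonomial (m₁ m₂ j p r : ℕ) (q : ℂ) :
    Gsum m₁ m₂ j (p + 1) (p + r + 2 * j) q =
      ∑ k₁ ∈ Finset.range (r + 1), ∑ k₂ ∈ Finset.range (p + 1),
        ∑ k₃ ∈ Finset.range (2 * j + 1),
          (r.choose k₁ : ℂ) * ((2 * j).choose k₃ : ℂ) * (p.choose k₂ : ℂ) *
            (qnum q 3 ^ (j + k₁ + k₂) / qnum q 2 ^ (2 * (p + r + 2 * j))) *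
              (gMonomial m₁ m₂ j (p + 1) (p + r + 2 * j) k₁ k₂ k₃ 1 q +
                gMonomial m₁ m₂ j (p + 1) (p + r + 2 * j) k₁ k₂ k₃ (-1) q) := by
  have hμ : ArithmeticFunction.moebius 2 = -1 :=
    ArithmeticFunction.moebius_apply_prime Nat.prime_two
  have hI : Finset.Icc 1 2 = ({1, 2} : Finset ℕ) := rfl
  rw [Gsum, Nat.add_sub_cancel, show p + r + 2 * j + 2 - (2 * j + (p + 1)) = r + 1 by omega,
    show p + r + 2 * j + 1 - (p + 1 + 2 * j) = r by omega, ← Nat.range_succ_eq_Icc_zero,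
    ← Nat.range_succ_eq_Icc_zero]
  refine Finset.sum_congr rfl fun k₁ _ => Finset.sum_congr rfl fun k₂ _ =>
    Finset.sum_congr rfl fun k₃ _ => ?_
  rw [hI, Finset.sum_pair (by norm_num), hμ, ArithmeticFunction.moebius_apply_one, gMonomial,
    gMonomial]
  push_cast
  ring

theorem phase_mul_gMonomial_one {m₁ m₂ j p r k₁ k₂ k₃ : ℕ} (h₁ : k₁ ≤ r) (h₂ : k₂ ≤ p)
    (h₃ : k₃ ≤ 2 * j) {q : ℂ} (hq : q ≠ 0) :
    (-1 : ℂ) ^ (-(((p + r + 2 * j : ℕ) : ℂ) * ((m₁ : ℂ) - (m₂ : ℂ))) / 2) *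
        gMonomial m₁ m₂ j (p + 1) (p + r + 2 * j) k₁ k₂ k₃ 1 q =
      eigenMonomial m₁ m₂ j p r k₁ k₂ k₃ q q (-q⁻¹) := by
  rw [eigenMonomial_eq_zpow h₁ h₂ h₃ hq (by simp [hq]), gMonomial, ← mul_assoc,
    neg_one_cpow_mul_cpow (e := (m₁ - m₂) * (-r - 2 * j) + m₂ * (k₂ - k₁) + k₃ * (m₂ + 1) - m₁ * j)
      (by push_cast; ring), ← zpow_add₀ hq]
  congr 1
  · refine neg_one_zpow_congr ⟨(m₁ - m₂) * (-r - j) + m₂ * (k₂ - k₁) - m₁ * j, by ring⟩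
  · congr 1
    push_cast
    ring

theorem phase_mul_gMonomial_neg_one {m₁ m₂ j p r k₁ k₂ k₃ : ℕ} (h₁ : k₁ ≤ r) (h₂ : k₂ ≤ p)
    (h₃ : k₃ ≤ 2 * j) {q : ℂ} (hq : q ≠ 0) :
    (-1 : ℂ) ^ (-(((p + r + 2 * j : ℕ) : ℂ) * ((m₁ : ℂ) - (m₂ : ℂ))) / 2) *
        gMonomial m₁ m₂ j (p + 1) (p + r + 2 * j) k₁ k₂ k₃ (-1) q =
      eigenMonomial m₁ m₂ j p r k₁ k₂ k₃ q (-q⁻¹) q := by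
  rw [eigenMonomial_eq_zpow h₁ h₂ h₃ hq (by simp [hq]), gMonomial, ← mul_assoc,
    neg_one_cpow_mul_cpow (e := -(m₁ - m₂) * p - m₂ * (k₂ - k₁) + k₃ * (m₂ + 1) - m₁ * j)
      (by push_cast; ring), neg_inv_zpow, mul_left_comm (q ^ _), ← zpow_add₀ hq, ← mul_assoc,
    ← zpow_add₀ (neg_ne_zero.mpr one_ne_zero)]
  congr 1
  · refine neg_one_zpow_congr ⟨-(m₁ - m₂) * p - m₂ * (k₂ - k₁) - m₁ * j, by ring⟩
  · congr 1
    push_cast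
    ring

theorem phase_mul_Gsum (m₁ m₂ j p r : ℕ) {q : ℂ} (hq : q ≠ 0) :
    (-1 : ℂ) ^ (-(((p + r + 2 * j : ℕ) : ℂ) * ((m₁ : ℂ) - (m₂ : ℂ))) / 2) *
        Gsum m₁ m₂ j (p + 1) (p + r + 2 * j) q =
      excursionWeight m₁ m₂ q ^ j *
        (loopWeight m₁ m₂ q q (-q⁻¹) ^ p * loopWeight m₁ m₂ q (-q⁻¹) q ^ r +
          loopWeight m₁ m₂ q (-q⁻¹) q ^ p * loopWeight m₁ m₂ q q (-q⁻¹) ^ r) := by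
  rw [mul_add, weight_pow_mul_eq_sum_eigenMonomial, weight_pow_mul_eq_sum_eigenMonomial,
    Gsum_eq_sum_gMonomial]
  simp only [Finset.mul_sum, ← Finset.sum_add_distrib]
  refine Finset.sum_congr rfl fun k₁ hk₁ => Finset.sum_congr rfl fun k₂ hk₂ =>
    Finset.sum_congr rfl fun k₃ hk₃ => ?_
  rw [Finset.mem_range_succ_iff] at hk₁ hk₂ hk₃
  rw [← phase_mul_gMonomial_one hk₁ hk₂ hk₃ hq, ← phase_mul_gMonomial_neg_one hk₁ hk₂ hk₃ hq]
  ring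

theorem Omega_eq_sum_weights (m₁ m₂ : ℕ) {n : ℕ} (hn : 0 < n) {q : ℂ} (hq : q ≠ 0) :
    Omega m₁ m₂ n q = ∑ j ∈ Finset.range (n / 2 + 1), ∑ k ∈ antidiagonal (n - 2 * j),
      (pathBinom j (k.1 + 1) : ℂ) * ((k.2 + j).choose j : ℂ) *
        (excursionWeight m₁ m₂ q ^ j *
          (loopWeight m₁ m₂ q (-q⁻¹) q ^ k.1 * loopWeight m₁ m₂ q q (-q⁻¹) ^ k.2 +
            loopWeight m₁ m₂ q q (-q⁻¹) ^ k.1 * loopWeight m₁ m₂ q (-q⁻¹) q ^ k.2)) := by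
  rw [Omega, ← Nat.range_succ_eq_Icc_zero]
  refine Finset.sum_congr rfl fun j hj => ?_
  have hj : 2 * j ≤ n := by have := Finset.mem_range.mp hj; omega
  refine (Finset.sum_congr rfl fun k _ => by ring).trans
    ((sum_pathBinom_mul_choose_eq_sum_antidiagonal hn hj fun k =>
      (-1) ^ (-((n : ℂ) * ((m₁ : ℂ) - (m₂ : ℂ))) / 2) * Gsum m₁ m₂ j k n q).trans ?_)
  refine Finset.sum_congr rfl fun k hk => ?_
  obtain rfl : n = k.1 + k.2 + 2 * j := by
    have := Finset.HasAntidiagonal.mem_antidiagonal.mp hk; omega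
  rw [phase_mul_Gsum m₁ m₂ j k.1 k.2 hq]
  ring

end OmegaExpansion

section Blocks

theorem B3.lift_sigma1 {G : Type*} [Group G] (a b : G) (h : a * b * a = b * a * b) :
    B3.lift a b h sigma1 = a :=
  PresentedGroup.toGroup.of _

theorem B3.lift_sigma2 {G : Type*} [Group G] (a b : G) (h : a * b * a = b * a * b) :
    B3.lift a b h sigma2 = b :=
  PresentedGroup.toGroup.of _

theorem B3.lift_hybridWeavingBraid {G : Type*} [Group G] (a b : G) (h : a * b * a = b * a * b)
    (m₁ m₂ n : ℕ) (ℓ : ℤ) :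
    B3.lift a b h (hybridWeavingBraid m₁ m₂ n ℓ) =
      (a ^ (m₁ : ℤ) * b ^ (-m₂ : ℤ)) ^ n * ((a * b) ^ 3) ^ ℓ := by
  simp only [hybridWeavingBraid, map_mul, map_pow, map_zpow, B3.lift_sigma1, B3.lift_sigma2,
    zpow_mul, zpow_ofNat]

theorem B3.lift_self_hybridWeavingBraid {G : Type*} [CommGroup G] (a : G) (m₁ m₂ n : ℕ) (ℓ : ℤ) :
    B3.lift a a rfl (hybridWeavingBraid m₁ m₂ n ℓ) = a ^ ((n : ℤ) * ((m₁ : ℤ) - m₂) + 6 * ℓ) := by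
  rw [B3.lift_hybridWeavingBraid, ← zpow_add, ← zpow_natCast, ← zpow_mul, ← sq, ← pow_mul,
    ← zpow_natCast a, ← zpow_mul, ← zpow_add]
  congr 1
  push_cast
  ring

theorem matrix_fin_two_cube_of_trace_of_det {R : Type*} [CommRing R]
    {M : Matrix (Fin 2) (Fin 2) R} {c : R} (htrace : M.trace = -c) (hdet : M.det = c ^ 2) :
    M ^ 3 = c ^ 3 • 1 := by
  nontriviality R
  have hM : M ^ 2 + c • M + c ^ 2 • (1 : Matrix (Fin 2) (Fin 2) R) = 0 := by
    simpa [Matrix.charpoly_fin_two, htrace, hdet, Algebra.algebraMap_eq_smul_one, smul_pow,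
      ← Algebra.smul_def] using M.aeval_self_charpoly
  have hM' : M ^ 2 = -(c • M + c ^ 2 • 1) := by rw [← sub_eq_zero, ← hM]; abel
  rw [pow_succ, hM', neg_mul, add_mul, smul_mul_assoc, smul_mul_assoc, ← sq, hM', one_mul]
  module

variable {q A : ℂ}

theorem R1block_val (h : Generic q A) :
    (R1block h).val = A⁻¹ • Matrix.diagonal ![q, -q⁻¹] := by
  rw [Matrix.diagonal_vec2]
  rfl

theorem R1block_zpow_val (h : Generic q A) (z : ℤ) :
    (R1block h ^ z).val = A⁻¹ ^ z • Matrix.diagonal ![q ^ z, (-q⁻¹) ^ z] := by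
  cases z with
  | ofNat n =>
    rw [Int.ofNat_eq_natCast, zpow_natCast, Units.val_pow_eq_pow_val, R1block_val, smul_pow,
      Matrix.diagonal_pow, zpow_natCast]
    congr 2
    ext i
    fin_cases i <;> simp
  | negSucc n =>
    have inv_val : (R1block h)⁻¹.val = A • Matrix.diagonal ![q⁻¹, -q] := by
      rw [Matrix.diagonal_vec2]
      rfl
    rw [zpow_negSucc, ← inv_pow, Units.val_pow_eq_pow_val, inv_val, smul_pow,
      Matrix.diagonal_pow, zpow_negSucc, inv_pow, inv_inv]
    congr 2
    ext i
    fin_cases i <;> simp [zpow_negSucc, ← inv_pow, inv_neg]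

/-- The matrix of `U diag(s, t) U⁻¹`, where `U` is the Racah matrix. -/
noncomputable def racahConj (q s t : ℂ) : Matrix (Fin 2) (Fin 2) ℂ :=
  (qnum q 2 ^ 2)⁻¹ • !![s + qnum q 3 * t, sqrtThree q * (t - s);
    sqrtThree q * (t - s), qnum q 3 * s + t]

theorem Ublock_mul_diagonal_mul_inv (h : Generic q A) (s t : ℂ) :
    (Ublock h).val * Matrix.diagonal ![s, t] * (Ublock h)⁻¹.val = racahConj q s t := by
  change (qnum q 2)⁻¹ • !![1, sqrtThree q; -sqrtThree q, 1] * Matrix.diagonal ![s, t] *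
    ((qnum q 2)⁻¹ • !![1, -sqrtThree q; sqrtThree q, 1]) = _
  rw [racahConj, ← sqrtThree_sq, Matrix.diagonal_fin_two]
  ext i j
  fin_cases i <;> fin_cases j <;> simp <;> ring

theorem R2block_zpow_val (h : Generic q A) (z : ℤ) :
    (R2block h ^ z).val = A⁻¹ ^ z • racahConj q (q ^ z) ((-q⁻¹) ^ z) := by
  rw [R2block, conj_zpow, Units.val_mul, Units.val_mul, R1block_zpow_val, mul_smul_comm,
    smul_mul_assoc, Ublock_mul_diagonal_mul_inv]

theorem det_R1block (h : Generic q A) : (R1block h).val.det = -A⁻¹ ^ 2 := by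
  have := h.q_ne
  rw [R1block_val, Matrix.det_smul, Matrix.det_diagonal]
  simp [this]

theorem trace_R1block (h : Generic q A) : (R1block h).val.trace = (q - q⁻¹) * A⁻¹ := by
  simp [R1block_val, mul_comm, sub_eq_add_neg]

theorem trace_R1block_mul_R2block (h : Generic q A) :
    (R1block h * R2block h).val.trace = -A⁻¹ ^ 2 := by
  have hR2 : (R2block h).val = A⁻¹ • racahConj q q (-q⁻¹) := by
    simpa using R2block_zpow_val h 1
  have hqnum : q ^ 2 + q⁻¹ ^ 2 - 2 * qnum q 3 = -qnum q 2 ^ 2 := by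
    rw [h.qnum_three, h.qnum_two]
    linear_combination -2 * mul_inv_cancel₀ h.q_ne
  calc (R1block h * R2block h).val.trace
      = A⁻¹ ^ 2 * (qnum q 2 ^ 2)⁻¹ * (q ^ 2 + q⁻¹ ^ 2 - 2 * (q * q⁻¹) * qnum q 3) := by
        rw [Units.val_mul, R1block_val, hR2, racahConj, Matrix.diagonal_vec2]
        simp only [Matrix.trace_fin_two, Matrix.mul_apply, Fin.sum_univ_two, Matrix.smul_apply,
          Matrix.of_apply, Matrix.cons_val', Matrix.cons_val_zero, Matrix.cons_val_one,
          Matrix.cons_val_fin_one, smul_eq_mul]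
        ring
    _ = -A⁻¹ ^ 2 := by
        rw [mul_inv_cancel₀ h.q_ne, mul_one, hqnum, mul_neg,
          inv_mul_cancel_right₀ (pow_ne_zero 2 h.qnum_two_ne)]

theorem R1block_mul_R2block_cube (h : Generic q A) :
    (R1block h * R2block h) ^ 3 =
      Units.map (algebraMap ℂ (Matrix (Fin 2) (Fin 2) ℂ)).toMonoidHom
        (Units.mk0 A⁻¹ (inv_ne_zero h.A_ne) ^ 6) := by
  have hdet : (R1block h * R2block h).val.det = (A⁻¹ ^ 2) ^ 2 := by
    rw [R2block, Units.val_mul, Units.val_mul, Units.val_mul, Matrix.det_mul,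
      Matrix.det_units_conj, det_R1block]
    ring
  ext1
  rw [Units.val_pow_eq_pow_val,
    matrix_fin_two_cube_of_trace_of_det (trace_R1block_mul_R2block h) hdet, ← pow_mul,
    ← Algebra.algebraMap_eq_smul_one]
  rfl

/-- The matrix of `σ₁^{m₁} σ₂^{-m₂}` on the multiplicity space of `[2,1,0]`, up to a power
of `A`. -/
noncomputable def weavingBlock (m₁ m₂ : ℕ) (q : ℂ) : Matrix (Fin 2) (Fin 2) ℂ :=
  Matrix.diagonal ![q ^ m₁, (-q⁻¹) ^ m₁] * racahConj q (q ^ (-m₂ : ℤ)) ((-q⁻¹) ^ (-m₂ : ℤ))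

theorem R1block_zpow_mul_R2block_zpow_val (h : Generic q A) (m₁ m₂ : ℕ) :
    (R1block h ^ (m₁ : ℤ) * R2block h ^ (-m₂ : ℤ)).val =
      A⁻¹ ^ ((m₁ : ℤ) - m₂) • weavingBlock m₁ m₂ q := by
  rw [Units.val_mul, R1block_zpow_val, R2block_zpow_val, smul_mul_smul_comm,
    ← zpow_add₀ (inv_ne_zero h.A_ne), ← sub_eq_add_neg, weavingBlock, zpow_natCast, zpow_natCast]

theorem trace_weavingBlock_pow (m₁ m₂ : ℕ) {n : ℕ} (hn : 0 < n) {q : ℂ} (hq : q ≠ 0) :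
    (weavingBlock m₁ m₂ q ^ n).trace = Omega m₁ m₂ n q := by
  have e00 : weavingBlock m₁ m₂ q 0 0 = loopWeight m₁ m₂ q q (-q⁻¹) := by
    simp only [weavingBlock, racahConj, loopWeight, Matrix.diagonal_mul, Matrix.smul_apply,
      smul_eq_mul, Matrix.of_apply, Matrix.cons_val', Matrix.cons_val_zero,
      Matrix.cons_val_fin_one]
    ring
  have e11 : weavingBlock m₁ m₂ q 1 1 = loopWeight m₁ m₂ q (-q⁻¹) q := by
    simp only [weavingBlock, racahConj, loopWeight, Matrix.diagonal_mul, Matrix.smul_apply,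
      smul_eq_mul, Matrix.of_apply, Matrix.cons_val', Matrix.cons_val_one,
      Matrix.cons_val_fin_one]
    ring
  have e01 : weavingBlock m₁ m₂ q 0 1 * weavingBlock m₁ m₂ q 1 0 = excursionWeight m₁ m₂ q := by
    have : q ^ m₁ * (-q⁻¹) ^ m₁ = (-1) ^ m₁ := by rw [← mul_pow]; simp [hq]
    rw [excursionWeight, ← sqrtThree_sq, ← this]
    simp only [weavingBlock, racahConj, Matrix.diagonal_mul, Matrix.smul_apply, smul_eq_mul,
      Matrix.of_apply, Matrix.cons_val', Matrix.cons_val_zero, Matrix.cons_val_one,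
      Matrix.cons_val_fin_one]
    ring
  rw [trace_matrix_pow, Omega_eq_sum_weights m₁ m₂ hn hq, e00, e11, e01]

theorem trace_rho21_hybridWeavingBraid (h : Generic q A) (m₁ m₂ : ℕ) {n : ℕ} (hn : 0 < n)
    (ℓ : ℤ) :
    (rho21 h (hybridWeavingBraid m₁ m₂ n ℓ)).val.trace =
      (1 / A) ^ ((n : ℤ) * ((m₁ : ℤ) - m₂) + 6 * ℓ) * Omega m₁ m₂ n q := by
  rw [rho21, B3.lift_hybridWeavingBraid, Units.val_mul, Units.val_pow_eq_pow_val,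
    R1block_zpow_mul_R2block_zpow_val, R1block_mul_R2block_cube, ← map_zpow, Units.coe_map,
    Units.val_zpow_eq_zpow_val, Units.val_pow_eq_pow_val, Units.val_mk0]
  change (_ * algebraMap ℂ (Matrix (Fin 2) (Fin 2) ℂ) _).trace = _
  rw [Algebra.algebraMap_eq_smul_one, smul_pow, smul_mul_smul_comm, mul_one, Matrix.trace_smul,
    trace_weavingBlock_pow m₁ m₂ hn h.q_ne, zpow_add₀ (one_div_ne_zero h.A_ne),
    one_div, mul_comm (n : ℤ), zpow_mul, zpow_mul, zpow_natCast, zpow_ofNat, smul_eq_mul]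

end Blocks

section SkeinTraces

theorem B3.artin : sigma1 * sigma2 * sigma1 = sigma2 * sigma1 * sigma2 :=
  mul_inv_eq_one.mp (PresentedGroup.one_of_mem (rels := artinRels) rfl)

theorem B3.induction {p : B3 → Prop} (one : p 1)
    (mul_sigma1 : ∀ β, p β → p (β * sigma1)) (mul_sigma2 : ∀ β, p β → p (β * sigma2))
    (mul_sigma1_inv : ∀ β, p β → p (β * sigma1⁻¹))
    (mul_sigma2_inv : ∀ β, p β → p (β * sigma2⁻¹)) (β : B3) : p β := by
  have hβ : β ∈ Subgroup.closure (Set.range (PresentedGroup.of (rels := artinRels))) := by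
    rw [PresentedGroup.closure_range_of]
    trivial
  induction hβ using Subgroup.closure_induction_right with
  | one => exact one
  | mul_right β _ g hg ih =>
    obtain ⟨i, rfl⟩ := hg
    fin_cases i
    exacts [mul_sigma1 _ ih, mul_sigma2 _ ih]
  | mul_inv_cancel β _ g hg ih =>
    obtain ⟨i, rfl⟩ := hg
    fin_cases i
    exacts [mul_sigma1_inv _ ih, mul_sigma2_inv _ ih]

variable {R : Type*} [CommRing R] {γ δ : R} {τ τ' : B3 → R}

/-- The class functions on `B₃` that satisfy the skein relation
`τ(σ₁² β) = γ τ(σ₁ β) + δ τ(β)`; equivalently, the traces of the Hecke algebra on three strands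
with generator relation `g² = γ g + δ`. -/
def skeinTraces (γ δ : R) : Submodule R (B3 → R) where
  carrier := {τ | (∀ β β', τ (β * β') = τ (β' * β)) ∧
    ∀ β, τ (sigma1 * (sigma1 * β)) = γ * τ (sigma1 * β) + δ * τ β}
  add_mem' h h' := by
    refine ⟨fun β β' => ?_, fun β => ?_⟩
    · simp only [Pi.add_apply, h.1 β, h'.1 β]
    · simp only [Pi.add_apply, h.2, h'.2]
      ring
  zero_mem' := by simp
  smul_mem' c τ h := by
    refine ⟨fun β β' => ?_, fun β => ?_⟩
    · simp only [Pi.smul_apply, h.1 β]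
    · simp only [Pi.smul_apply, h.2, smul_eq_mul]
      ring

theorem sigma2_eq_conj : sigma2 = sigma1 * sigma2 * sigma1 * (sigma1 * sigma2)⁻¹ := by
  rw [eq_mul_inv_iff_mul_eq, ← mul_assoc, B3.artin]

theorem apply_sigma2_of_mem_skeinTraces (hτ : τ ∈ skeinTraces γ δ) : τ sigma2 = τ sigma1 := by
  rw [sigma2_eq_conj, mul_assoc, hτ.1, mul_assoc, inv_mul_cancel, mul_one]

theorem apply_mul_sigma1_sq_mul_of_mem_skeinTraces (hτ : τ ∈ skeinTraces γ δ) (β β' : B3) :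
    τ (β * sigma1 * sigma1 * β') = γ * τ (β * sigma1 * β') + δ * τ (β * β') := by
  simp only [mul_assoc, hτ.1 β, hτ.2]

theorem apply_mul_sigma2_sq_mul_of_mem_skeinTraces (hτ : τ ∈ skeinTraces γ δ) (β β' : B3) :
    τ (β * sigma2 * sigma2 * β') = γ * τ (β * sigma2 * β') + δ * τ (β * β') := by
  have h := apply_mul_sigma1_sq_mul_of_mem_skeinTraces hτ (β * (sigma1 * sigma2))
    ((sigma1 * sigma2)⁻¹ * β')
  rw [sigma2_eq_conj]
  simpa only [mul_inv_rev, mul_assoc, inv_mul_cancel_left, mul_inv_cancel_left] using h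

/-- The six words `1, x, y, xy, yx, xyx`. For the generators of the Hecke algebra on three strands
they form the standard basis. -/
def standardWords {G : Type*} [Monoid G] (x y : G) : Set G :=
  {1, x, y, x * y, y * x, x * y * x}

theorem standardWords_comm {G : Type*} [Monoid G] {x y : G} (hxy : x * y * x = y * x * y) :
    standardWords x y = standardWords y x := by
  ext w
  simp only [standardWords, hxy, Set.mem_insert_iff, Set.mem_singleton_iff]
  tauto

theorem apply_mul_mul_standardWords_eq_zero {G : Type*} [Monoid G] {x y : G} {τ : G → R}
    (hx : ∀ g g', τ (g * x * x * g') = γ * τ (g * x * g') + δ * τ (g * g')) {g : G}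
    (hg : ∀ w ∈ standardWords x y, τ (g * w) = 0) :
    ∀ w ∈ standardWords x y, τ (g * x * w) = 0 := by
  have skein : ∀ u, τ (g * (x * u)) = 0 → τ (g * u) = 0 → τ (g * (x * (x * u))) = 0 := by
    intro u hxu hu
    have := hx g u
    simp only [mul_assoc] at this
    rw [this, hxu, hu, mul_zero, mul_zero, add_zero]
  simp only [standardWords, Set.forall_mem_insert, Set.mem_singleton_iff, forall_eq, mul_assoc,
    mul_one] at hg ⊢
  obtain ⟨h_one, h_x, h_y, h_xy, h_yx, h_xyx⟩ := hg
  exact ⟨h_x, by simpa using skein 1 (by simpa) (by simpa), h_xy, skein _ h_xy h_y, h_xyx,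
    skein _ h_xyx h_yx⟩

theorem apply_mul_inv_mul_eq_zero {G : Type*} [Group G] {x : G} {τ : G → R} (hδ : IsUnit δ)
    (hx : ∀ g g', τ (g * x * x * g') = γ * τ (g * x * g') + δ * τ (g * g')) {g w : G}
    (hw : τ (g * w) = 0) (hxw : τ (g * x * w) = 0) : τ (g * x⁻¹ * w) = 0 := by
  have h := hx (g * x⁻¹) w
  rwa [inv_mul_cancel_right, hxw, hw, mul_zero, zero_add, eq_comm, hδ.mul_right_eq_zero] at h

theorem eq_zero_of_mem_skeinTraces (hδ : IsUnit δ) (hτ : τ ∈ skeinTraces γ δ) (h0 : τ 1 = 0)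
    (h1 : τ sigma1 = 0) (h12 : τ (sigma1 * sigma2) = 0) : τ = 0 := by
  have hσ₁ := apply_mul_sigma1_sq_mul_of_mem_skeinTraces hτ
  have hσ₂ := apply_mul_sigma2_sq_mul_of_mem_skeinTraces hτ
  have mul_sigma1 {β : B3} (hβ : ∀ w ∈ standardWords sigma1 sigma2, τ (β * w) = 0) :
      ∀ w ∈ standardWords sigma1 sigma2, τ (β * sigma1 * w) = 0 :=
    apply_mul_mul_standardWords_eq_zero hσ₁ hβ
  have mul_sigma2 {β : B3} (hβ : ∀ w ∈ standardWords sigma1 sigma2, τ (β * w) = 0) :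
      ∀ w ∈ standardWords sigma1 sigma2, τ (β * sigma2 * w) = 0 := by
    rw [standardWords_comm B3.artin] at hβ ⊢
    exact apply_mul_mul_standardWords_eq_zero hσ₂ hβ
  suffices ∀ β, ∀ w ∈ standardWords sigma1 sigma2, τ (β * w) = 0 by
    ext β
    simpa using this β 1 (by simp [standardWords])
  intro β
  induction β using B3.induction with
  | one =>
    have h2 : τ sigma2 = 0 := (apply_sigma2_of_mem_skeinTraces hτ).trans h1
    have h21 : τ (sigma2 * sigma1) = 0 := (hτ.1 _ _).trans h12
    have h121 : τ (sigma1 * sigma2 * sigma1) = 0 := by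
      rw [hτ.1, hτ.2, h12, h2, mul_zero, mul_zero, add_zero]
    simp [standardWords, h0, h1, h2, h12, h21, h121]
  | mul_sigma1 β ih => exact mul_sigma1 ih
  | mul_sigma2 β ih => exact mul_sigma2 ih
  | mul_sigma1_inv β ih =>
    exact fun w hw => apply_mul_inv_mul_eq_zero hδ hσ₁ (ih w hw) (mul_sigma1 ih w hw)
  | mul_sigma2_inv β ih =>
    exact fun w hw => apply_mul_inv_mul_eq_zero hδ hσ₂ (ih w hw) (mul_sigma2 ih w hw)

theorem skeinTraces_ext (hδ : IsUnit δ) (hτ : τ ∈ skeinTraces γ δ) (hτ' : τ' ∈ skeinTraces γ δ)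
    (h0 : τ 1 = τ' 1) (h1 : τ sigma1 = τ' sigma1)
    (h12 : τ (sigma1 * sigma2) = τ' (sigma1 * sigma2)) : τ = τ' :=
  sub_eq_zero.mp <| eq_zero_of_mem_skeinTraces hδ (sub_mem hτ hτ') (sub_eq_zero.mpr h0)
    (sub_eq_zero.mpr h1) (sub_eq_zero.mpr h12)

theorem comp_mem_skeinTraces {P : Type*} [Ring P] [Algebra R P] (φ : B3 →* Pˣ) (T : P →ₗ[R] R)
    (hT : ∀ β β', T (φ β * φ β') = T (φ β' * φ β))
    (hφ : (φ sigma1).val * φ sigma1 = γ • (φ sigma1).val + δ • 1) :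
    (fun β => T (φ β)) ∈ skeinTraces γ δ := by
  refine ⟨fun β β' => ?_, fun β => ?_⟩
  · simp only [map_mul, Units.val_mul, hT β]
  · simp only [map_mul, Units.val_mul]
    rw [← mul_assoc, hφ, add_mul, smul_mul_assoc, smul_mul_assoc, one_mul, map_add, map_smul,
      map_smul, smul_eq_mul, smul_eq_mul]

end SkeinTraces

section QuantumTrace

/-- The diagonal entries of the braiding on `V ⊗ V`. -/
noncomputable def braidingDiag {N : ℕ} (q : ℂ) (a b : Fin N) : ℂ :=
  if a = b then q else if a < b then q - q⁻¹ else 0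

/-- The diagonal entries of `K`. -/
noncomputable def kDiag (N : ℕ) (q : ℂ) (a : Fin N) : ℂ := q ^ (2 * (a : ℤ) + 1 - N)

theorem trace_K3_mul (N : ℕ) (q : ℂ) (f : Module.End ℂ (V3 N)) :
    LinearMap.trace ℂ (V3 N) (K3 N q * f) =
      ∑ a, ∑ b, ∑ c, kDiag N q a * kDiag N q b * kDiag N q c *
        f (Pi.single (a, b, c) 1) (a, b, c) := by
  rw [LinearMap.trace_eq_matrix_trace ℂ (Pi.basisFun ℂ _), Matrix.trace,
    Fintype.sum_prod_type]
  refine Finset.sum_congr rfl fun a _ => ?_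
  rw [Fintype.sum_prod_type]
  refine Finset.sum_congr rfl fun b _ => Finset.sum_congr rfl fun c _ => ?_
  simp [K3, kDiag]

theorem sub_inv_mul_kDiag {N : ℕ} {q : ℂ} (hq : q ≠ 0) (a : Fin N) :
    (q - q⁻¹) * kDiag N q a = q ^ (2 * ((a + 1 : ℕ) : ℤ) - N) - q ^ (2 * (a : ℤ) - N) := by
  have e1 : q ^ (2 * ((a + 1 : ℕ) : ℤ) - N) = kDiag N q a * q := by
    
    rw [kDiag, ← zpow_add_one₀ hq]
    congr 1
    push_cast
    ring
  have e2 : q ^ (2 * (a : ℤ) - N) = kDiag N q a * q⁻¹ := by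
    
    rw [kDiag, ← zpow_sub_one₀ hq]
    congr 1
    ring
  rw [e1, e2]
  ring

theorem sum_kDiag (N : ℕ) {q : ℂ} (hq : q ≠ 0) (hq' : q - q⁻¹ ≠ 0) :
    ∑ a, kDiag N q a = qnum q N := by
  rw [qnum, eq_div_iff hq', mul_comm, Finset.mul_sum]
  simp only [sub_inv_mul_kDiag hq]
  rw [Fin.sum_univ_eq_sum_range
    (fun m : ℕ => q ^ (2 * ((m + 1 : ℕ) : ℤ) - N) - q ^ (2 * (m : ℤ) - N)),
    Finset.sum_range_sub (fun m : ℕ => q ^ (2 * (m : ℤ) - N))]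
  congr 2 <;> push_cast <;> ring

theorem sum_kDiag_mul_braidingDiag (N : ℕ) {q : ℂ} (hq : q ≠ 0) (b : Fin N) :
    ∑ c, kDiag N q c * braidingDiag q b c = q ^ N := by
  let T : ℕ → ℂ := fun m => if m ≤ b then 0 else q ^ (2 * (m : ℤ) - N)
  have h : ∀ c : Fin N, kDiag N q c * braidingDiag q b c = T (c + 1) - T c := by
    intro c
    have h1 := sub_inv_mul_kDiag hq c
    rcases lt_trichotomy b c with hbc | rfl | hbc
    · have : (b : ℕ) < c := hbc
      simp only [T, braidingDiag, if_neg hbc.ne, if_pos hbc, if_neg this.not_ge,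
        if_neg (show ¬ (c + 1 : ℕ) ≤ b by omega), ← h1]
      ring
    · simp only [T, braidingDiag, if_true, le_refl, kDiag, if_neg (show ¬ (b + 1 : ℕ) ≤ b by omega),
        ← zpow_add_one₀ hq, sub_zero]
      congr 1
      push_cast
      ring
    · have : (c : ℕ) < b := hbc
      simp only [T, braidingDiag, if_neg hbc.ne', if_neg hbc.not_gt, if_pos this.le,
        if_pos (show (c + 1 : ℕ) ≤ b by omega)]
      ring
  rw [Finset.sum_congr rfl fun c _ => h c,
    Fin.sum_univ_eq_sum_range (fun m : ℕ => T (m + 1) - T m), Finset.sum_range_sub T]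
  simp only [T, Nat.zero_le, if_true, if_neg b.isLt.not_ge, sub_zero]
  rw [← zpow_natCast]
  congr 1
  ring

theorem trace_K3 (N : ℕ) {q : ℂ} (hq : q ≠ 0) (hq' : q - q⁻¹ ≠ 0) :
    LinearMap.trace ℂ (V3 N) (K3 N q) = qnum q N ^ 3 := by
  rw [← mul_one (K3 N q), trace_K3_mul]
  simp only [Module.End.one_apply, Pi.single_eq_same, mul_one, ← Finset.mul_sum,
    ← Finset.sum_mul, sum_kDiag N hq hq']
  ring

theorem trace_K3_mul_Rcheck1 (N : ℕ) {q : ℂ} (hq : q ≠ 0) (hq' : q - q⁻¹ ≠ 0) :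
    LinearMap.trace ℂ (V3 N) (K3 N q * Rcheck1 N q) = q ^ N * qnum q N ^ 2 := by
  have h : ∀ a b c, Rcheck1 N q (Pi.single (a, b, c) 1) (a, b, c) = braidingDiag q a b := by
    intro a b c
    simp only [Rcheck1, braidingDiag, LinearMap.coe_mk, AddHom.coe_mk, Pi.single_apply]
    split_ifs <;> simp_all
  have h' : ∀ a b c, kDiag N q a * kDiag N q b * kDiag N q c * braidingDiag q a b =
      kDiag N q a * (kDiag N q b * braidingDiag q a b) * kDiag N q c := fun a b c => by ring
  simp only [trace_K3_mul, h, h', ← Finset.mul_sum, ← Finset.sum_mul, sum_kDiag N hq hq',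
    sum_kDiag_mul_braidingDiag N hq]
  ring

theorem trace_K3_mul_Rcheck1_mul_Rcheck2 (N : ℕ) {q : ℂ} (hq : q ≠ 0) (hq' : q - q⁻¹ ≠ 0) :
    LinearMap.trace ℂ (V3 N) (K3 N q * (Rcheck1 N q * Rcheck2 N q)) =
      (q ^ N) ^ 2 * qnum q N := by
  have h : ∀ a b c, (Rcheck1 N q * Rcheck2 N q) (Pi.single (a, b, c) 1) (a, b, c) =
      braidingDiag q a b * braidingDiag q b c := by
    intro a b c
    simp only [Rcheck1, Rcheck2, braidingDiag, Module.End.mul_apply, LinearMap.coe_mk,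
      AddHom.coe_mk, Pi.single_apply, Prod.mk.injEq]
    split_ifs <;> grind
  have h' : ∀ a b c, kDiag N q a * kDiag N q b * kDiag N q c *
      (braidingDiag q a b * braidingDiag q b c) = kDiag N q a *
        ((kDiag N q b * braidingDiag q a b) * (kDiag N q c * braidingDiag q b c)) :=
    fun a b c => by ring
  simp only [trace_K3_mul, h, h', ← Finset.mul_sum, ← Finset.sum_mul, sum_kDiag N hq hq',
    sum_kDiag_mul_braidingDiag N hq]
  ring

theorem commute_K3_Rcheck1 (N : ℕ) (q : ℂ) : Commute (K3 N q) (Rcheck1 N q) := by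
  refine LinearMap.ext fun f => funext fun ⟨a, b, c⟩ => ?_
  simp only [K3, Rcheck1, Module.End.mul_apply, LinearMap.coe_mk, AddHom.coe_mk]
  split_ifs <;> ring

theorem commute_K3_Rcheck2 (N : ℕ) (q : ℂ) : Commute (K3 N q) (Rcheck2 N q) := by
  refine LinearMap.ext fun f => funext fun ⟨a, b, c⟩ => ?_
  simp only [K3, Rcheck2, Module.End.mul_apply, LinearMap.coe_mk, AddHom.coe_mk]
  split_ifs <;> ring

theorem piV_sigma1_val (N : ℕ) {q : ℂ} (hq : q ≠ 0) :
    (piV N hq sigma1).val = (q ^ N)⁻¹ • Rcheck1 N q := by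
  rw [piV, B3.lift_sigma1]
  rfl

theorem piV_sigma2_val (N : ℕ) {q : ℂ} (hq : q ≠ 0) :
    (piV N hq sigma2).val = (q ^ N)⁻¹ • Rcheck2 N q := by
  rw [piV, B3.lift_sigma2]
  rfl

theorem commute_K3_piV (N : ℕ) {q : ℂ} (hq : q ≠ 0) (β : B3) :
    Commute (K3 N q) (piV N hq β).val := by
  have h1 : Commute (K3 N q) (piV N hq sigma1).val := by
    rw [piV_sigma1_val]
    exact (commute_K3_Rcheck1 N q).smul_right _
  have h2 : Commute (K3 N q) (piV N hq sigma2).val := by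
    rw [piV_sigma2_val]
    exact (commute_K3_Rcheck2 N q).smul_right _
  induction β using B3.induction with
  | one => simp
  | mul_sigma1 β ih => simpa using ih.mul_right h1
  | mul_sigma2 β ih => simpa using ih.mul_right h2
  | mul_sigma1_inv β ih => simpa using ih.mul_right h1.units_inv_right
  | mul_sigma2_inv β ih => simpa using ih.mul_right h2.units_inv_right

theorem quantumTraceInvariant_mem_skeinTraces (N : ℕ) {q : ℂ} (hq : q ≠ 0) :
    quantumTraceInvariant N hq ∈ skeinTraces ((q - q⁻¹) * (q ^ N)⁻¹) ((q ^ N)⁻¹ ^ 2) := by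
  let T : Module.End ℂ (V3 N) →ₗ[ℂ] ℂ :=
    (qnum q N)⁻¹ • LinearMap.trace ℂ (V3 N) ∘ₗ LinearMap.mulLeft ℂ (K3 N q)
  have hT : quantumTraceInvariant N hq = fun β => T (piV N hq β) := by
    ext β
    simp [T, quantumTraceInvariant, div_eq_inv_mul]
  rw [hT]
  refine comp_mem_skeinTraces _ T (fun β β' => ?_) ?_
  · simp only [T, LinearMap.smul_apply, LinearMap.comp_apply, LinearMap.mulLeft_apply]
    rw [← mul_assoc, LinearMap.trace_mul_comm, ← mul_assoc, ← (commute_K3_piV N hq β').eq,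
      mul_assoc]
  · rw [piV_sigma1_val, smul_mul_smul_comm, Rcheck1_sq N hq]
    module

theorem quantumTraceInvariant_one (N : ℕ) {q : ℂ} (hq : q ≠ 0) (hq' : q - q⁻¹ ≠ 0) :
    quantumTraceInvariant N hq 1 = qnum q N ^ 2 := by
  rw [quantumTraceInvariant, map_one, Units.val_one, mul_one, trace_K3 N hq hq', pow_succ]
  exact mul_div_cancel_of_imp fun h => by rw [h, sq, zero_mul]

theorem quantumTraceInvariant_sigma1 (N : ℕ) {q : ℂ} (hq : q ≠ 0) (hq' : q - q⁻¹ ≠ 0) :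
    quantumTraceInvariant N hq sigma1 = qnum q N := by
  rw [quantumTraceInvariant, piV_sigma1_val, mul_smul_comm, map_smul,
    trace_K3_mul_Rcheck1 N hq hq', smul_eq_mul, inv_mul_cancel_left₀ (pow_ne_zero N hq), sq]
  exact mul_self_div_self _

theorem quantumTraceInvariant_sigma1_mul_sigma2 (N : ℕ) {q : ℂ} (hq : q ≠ 0)
    (hq' : q - q⁻¹ ≠ 0) (hN : qnum q N ≠ 0) :
    quantumTraceInvariant N hq (sigma1 * sigma2) = 1 := by
  have hqN := pow_ne_zero N hq
  rw [quantumTraceInvariant, map_mul (piV N hq), Units.val_mul, piV_sigma1_val, piV_sigma2_val,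
    smul_mul_smul_comm, mul_smul_comm, map_smul, trace_K3_mul_Rcheck1_mul_Rcheck2 N hq hq',
    smul_eq_mul]
  field_simp

end QuantumTrace

section Homfly

variable {q A : ℂ}

theorem qnumA_eq_div (hq : q ≠ 0) (hA : A ≠ 0) (k : ℤ) :
    qnumA A q k = q * (A ^ 2 * q ^ (2 * k) - 1) / (A * q ^ k * (q ^ 2 - 1)) := by
  have hsub : q - q⁻¹ = (q ^ 2 - 1) / q := by field_simp
  have hnum : A * q ^ k - A⁻¹ * q ^ (-k) = (A ^ 2 * q ^ (2 * k) - 1) / (A * q ^ k) := by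
    rw [zpow_neg, mul_comm 2, zpow_mul, zpow_ofNat]
    field_simp
  rw [qnumA, hsub, hnum, div_div_div_eq, mul_comm q]

theorem qnum_eq_div (hq : q ≠ 0) (k : ℤ) :
    qnum q k = q * (q ^ (2 * k) - 1) / (q ^ k * (q ^ 2 - 1)) := by
  simpa [qnum, qnumA] using qnumA_eq_div hq one_ne_zero k

theorem Generic.q_sq_sub_one_ne (h : Generic q A) : q ^ 2 - 1 ≠ 0 :=
  fun h0 => h.q4_ne (by linear_combination (q ^ 2 + 1) * h0)

theorem S1_eq_div (hq : q ≠ 0) (hA : A ≠ 0) :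
    S1 A q = q * (A ^ 2 - 1) / (A * (q ^ 2 - 1)) := by
  simp only [S1, qnumA_eq_div hq hA, mul_zero, zpow_zero, mul_one]

theorem Generic.S1_ne_zero (h : Generic q A) : S1 A q ≠ 0 := by
  rw [S1_eq_div h.q_ne h.A_ne]
  exact div_ne_zero (mul_ne_zero h.q_ne (sub_ne_zero.mpr h.A2_ne))
    (mul_ne_zero h.A_ne h.q_sq_sub_one_ne)

theorem Generic.S3_eq_div (h : Generic q A) :
    S3 A q = q ^ 3 * (A ^ 2 - 1) * (A ^ 2 * q ^ 2 - 1) * (A ^ 2 * q ^ 4 - 1) /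
      (A ^ 3 * (q ^ 2 - 1) * (q ^ 4 - 1) * (q ^ 6 - 1)) := by
  have hq := h.q_ne
  have hA := h.A_ne
  have hq2 := h.q_sq_sub_one_ne
  have hq4 := sub_ne_zero.mpr h.q4_ne
  have hq6 := sub_ne_zero.mpr h.q6_ne
  simp only [S3, qnum_eq_div hq, qnumA_eq_div hq hA, mul_zero, zpow_ofNat, pow_zero, mul_one,
    pow_one, Int.reduceMul]
  field_simp

theorem Generic.S111_eq_div (h : Generic q A) :
    S111 A q = q ^ 3 * (A ^ 2 - 1) * (A ^ 2 - q ^ 2) * (A ^ 2 - q ^ 4) /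
      (A ^ 3 * (q ^ 2 - 1) * (q ^ 4 - 1) * (q ^ 6 - 1)) := by
  have hq := h.q_ne
  have hA := h.A_ne
  have hq2 := h.q_sq_sub_one_ne
  have hq4 := sub_ne_zero.mpr h.q4_ne
  have hq6 := sub_ne_zero.mpr h.q6_ne
  simp only [S111, qnum_eq_div hq, qnumA_eq_div hq hA, mul_zero, zpow_ofNat, pow_zero, mul_one,
    pow_one, Int.reduceMul, Int.reduceNeg, mul_neg, zpow_neg]
  field_simp

theorem Generic.S21_eq_div (h : Generic q A) :
    S21 A q = q ^ 3 * (A ^ 2 - 1) * (A ^ 2 * q ^ 2 - 1) * (A ^ 2 - q ^ 2) /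
      (A ^ 3 * (q ^ 2 - 1) ^ 2 * (q ^ 6 - 1)) := by
  have hq := h.q_ne
  have hA := h.A_ne
  have hq2 := h.q_sq_sub_one_ne
  have hq6 := sub_ne_zero.mpr h.q6_ne
  simp only [S21, qnum_eq_div hq, qnumA_eq_div hq hA, mul_zero, zpow_ofNat, pow_zero, mul_one,
    pow_one, Int.reduceMul, Int.reduceNeg, mul_neg, zpow_neg]
  field_simp

theorem homflyPT_one (h : Generic q A) : homflyPT h 1 = S1 A q ^ 2 := by
  have hq := h.q_ne
  have hA := h.A_ne
  have hq2 := h.q_sq_sub_one_ne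
  have hq4 := sub_ne_zero.mpr h.q4_ne
  have hq6 := sub_ne_zero.mpr h.q6_ne
  have hS1 := h.S1_ne_zero
  have hsum : S3 A q + S111 A q + S21 A q * 2 = S1 A q ^ 3 := by
    rw [S1_eq_div hq hA, h.S3_eq_div, h.S111_eq_div, h.S21_eq_div]
    field_simp
    ring
  simp only [homflyPT, map_one, Units.val_one, Matrix.trace_one, Fintype.card_fin, Nat.cast_ofNat,
    mul_one, hsum]
  field_simp

theorem homflyPT_sigma1 (h : Generic q A) : homflyPT h sigma1 = S1 A q := by
  have hq := h.q_ne
  have hA := h.A_ne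
  have hq2 := h.q_sq_sub_one_ne
  have hq4 := sub_ne_zero.mpr h.q4_ne
  have hq6 := sub_ne_zero.mpr h.q6_ne
  have hS1 := h.S1_ne_zero
  have hsum : S3 A q * (q / A) + S111 A q * (-1 / (q * A)) + S21 A q * ((q - q⁻¹) * A⁻¹) =
      S1 A q ^ 2 := by
    rw [S1_eq_div hq hA, h.S3_eq_div, h.S111_eq_div, h.S21_eq_div]
    field_simp
    ring
  simp only [homflyPT, rho3, rho111, rho21, B3.lift_sigma1, Units.val_mk0, trace_R1block, hsum]
  field_simp

theorem homflyPT_sigma1_mul_sigma2 (h : Generic q A) : homflyPT h (sigma1 * sigma2) = 1 := by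
  have hq := h.q_ne
  have hA := h.A_ne
  have hq2 := h.q_sq_sub_one_ne
  have hq4 := sub_ne_zero.mpr h.q4_ne
  have hq6 := sub_ne_zero.mpr h.q6_ne
  have hS1 := h.S1_ne_zero
  have hsum : S3 A q * (q / A * (q / A)) + S111 A q * (-1 / (q * A) * (-1 / (q * A))) +
      S21 A q * (-A⁻¹ ^ 2) = S1 A q := by
    rw [S1_eq_div hq hA, h.S3_eq_div, h.S111_eq_div, h.S21_eq_div]
    field_simp
    ring
  simp only [homflyPT, rho3, rho111, rho21, map_mul, B3.lift_sigma1, B3.lift_sigma2]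
  rw [trace_R1block_mul_R2block, Units.val_mul, Units.val_mul, Units.val_mk0, Units.val_mk0, hsum,
    one_div_mul_cancel hS1]

theorem R1block_sq (h : Generic q A) :
    (R1block h).val * (R1block h).val =
      ((q - q⁻¹) * A⁻¹) • (R1block h).val + (A⁻¹ ^ 2) • 1 := by
  have hq := h.q_ne
  rw [R1block_val]
  ext i j
  fin_cases i <;> fin_cases j <;> simp <;> field_simp <;> ring

theorem homflyPT_mem_skeinTraces (h : Generic q A) :
    homflyPT h ∈ skeinTraces ((q - q⁻¹) * A⁻¹) (A⁻¹ ^ 2) := by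
  have hq := h.q_ne
  have hA := h.A_ne
  have h3 : (fun β => (rho3 h β).val) ∈ skeinTraces ((q - q⁻¹) * A⁻¹) (A⁻¹ ^ 2) :=
    comp_mem_skeinTraces (rho3 h) LinearMap.id (fun _ _ => mul_comm _ _) (by
      rw [rho3, B3.lift_sigma1, Units.val_mk0, smul_eq_mul, smul_eq_mul]
      field_simp
      ring)
  have h111 : (fun β => (rho111 h β).val) ∈ skeinTraces ((q - q⁻¹) * A⁻¹) (A⁻¹ ^ 2) :=
    comp_mem_skeinTraces (rho111 h) LinearMap.id (fun _ _ => mul_comm _ _) (by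
      rw [rho111, B3.lift_sigma1, Units.val_mk0, smul_eq_mul, smul_eq_mul]
      field_simp
      ring)
  have h21 : (fun β => (rho21 h β).val.trace) ∈ skeinTraces ((q - q⁻¹) * A⁻¹) (A⁻¹ ^ 2) :=
    comp_mem_skeinTraces (rho21 h) (Matrix.traceLinearMap _ ℂ ℂ)
      (fun β β' => Matrix.trace_mul_comm (rho21 h β).val (rho21 h β').val) (by
        rw [rho21, B3.lift_sigma1]
        exact R1block_sq h)
  exact Submodule.smul_mem _ (1 / S1 A q) (add_mem (add_mem (Submodule.smul_mem _ (S3 A q) h3)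
    (Submodule.smul_mem _ (S111 A q) h111)) (Submodule.smul_mem _ (S21 A q) h21))

theorem S1_pow (N : ℕ) (q : ℂ) : S1 (q ^ N) q = qnum q N := by
  simp [S1, qnumA, qnum]

theorem quantumTraceInvariant_eq_homflyPT (N : ℕ) (h : Generic q (q ^ N)) :
    quantumTraceInvariant N h.q_ne = homflyPT h := by
  have hδ : IsUnit ((q ^ N)⁻¹ ^ 2) := (pow_ne_zero 2 (inv_ne_zero h.A_ne)).isUnit
  have hN : qnum q N ≠ 0 := S1_pow N q ▸ h.S1_ne_zero
  refine skeinTraces_ext hδ (quantumTraceInvariant_mem_skeinTraces N h.q_ne)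
    (homflyPT_mem_skeinTraces h) ?_ ?_ ?_
  · rw [quantumTraceInvariant_one N h.q_ne h.sub_inv_ne, homflyPT_one, S1_pow]
  · rw [quantumTraceInvariant_sigma1 N h.q_ne h.sub_inv_ne, homflyPT_sigma1, S1_pow]
  · rw [quantumTraceInvariant_sigma1_mul_sigma2 N h.q_ne h.sub_inv_ne hN,
      homflyPT_sigma1_mul_sigma2]

end Homfly

theorem proposition2 (m₁ m₂ n : ℕ) (hm₁ : 0 < m₁) (hm₂ : 0 < m₂) (hn : 0 < n) (ℓ : ℤ)
    (α : ℤ) (hα : α = (m₁ : ℤ) - (m₂ : ℤ)) (q A : ℂ) (h : Generic q A) :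
    homflyPT h (hybridWeavingBraid m₁ m₂ n ℓ) =
        1 / S1 A q *
          ((q / A) ^ ((n : ℤ) * α + 6 * ℓ) * S3 A q +
            (-(q * A)) ^ (-((n : ℤ) * α) - 6 * ℓ) * S111 A q +
            (1 / A) ^ ((n : ℤ) * α + 6 * ℓ) * S21 A q * Omega m₁ m₂ n q) ∧
      ∀ N : ℕ, A = q ^ N →
        quantumTraceInvariant N h.q_ne (hybridWeavingBraid m₁ m₂ n ℓ) =
          1 / S1 A q *
            ((q / A) ^ ((n : ℤ) * α + 6 * ℓ) * S3 A q +
              (-(q * A)) ^ (-((n : ℤ) * α) - 6 * ℓ) * S111 A q +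
              (1 / A) ^ ((n : ℤ) * α + 6 * ℓ) * S21 A q * Omega m₁ m₂ n q) := by
  subst hα
  refine (and_iff_left_of_imp fun H N hN => ?_).mpr ?_
  · subst hN
    rw [quantumTraceInvariant_eq_homflyPT N h, H]
  · have hneg : -1 / (q * A) = (-(q * A))⁻¹ := by rw [neg_div, one_div, inv_neg]
    rw [homflyPT, rho3, rho111, B3.lift_self_hybridWeavingBraid, B3.lift_self_hybridWeavingBraid,
      trace_rho21_hybridWeavingBraid h m₁ m₂ hn, Units.val_zpow_eq_zpow_val,
      Units.val_zpow_eq_zpow_val, Units.val_mk0, Units.val_mk0, hneg, inv_zpow', neg_add']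
    ring
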